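/- **Setting.** Two subnetworks $\Sigma_1,\Sigma_2$ have $n_1,n_2\ge 1$ agents, $\mathcal V_l=\{1,\dots,n_l\}$, and action sets $\mathcal X_l\subset\mathbb R^{m_l}$. Agent $i\in\mathcal V_l$ has a cost $f_{l,i}(x_1,x_2)$; put $f_l=\frac1{n_l}\sum_{i=1}^{n_l}f_{l,i}$, assume $f_1+f_2=0$ on $\mathcal X_1\times\mathcal X_2$, and let $U=f_1$. A Nash equilibrium (NE) is a pair $(x_1^*,x_2^*)\in\mathcal X_1\times\mathcal X_2$ with $x_1^*\in\arg\min_{x_1\in\mathcal X_1}U(x_1,x_2^*)$ and $x_2^*\in\arg\max_{x_2\in\mathcal X_2}U(x_1^*,x_2)$. On each $\mathbb R^{m_l}$, $\|\cdot\|$ is an $\ell_p$ norm, $p\ge1$. **Assumption 1.** (i) $\mathcal X_1,\mathcal X_2$ are compact and convex. There are open sets $\mathcal O_l\supseteq\mathcal X_l$ such that $f_{1,i}$ is defined on $\mathcal O_1\times\mathcal X_2$ and $f_{2,i}$ on $\mathcal X_1\times\mathcal O_2$, and: (ii) $f_{1,i}(\cdot,x_2)$ is convex on the convex set $\mathcal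 O_1$ for each $x_2\in\mathcal X_2$ and $f_{1,i}(x_1,\cdot)$ is concave on $\mathcal X_2$ for each $x_1\in\mathcal X_1$; $f_{2,i}(x_1,\cdot)$ is convex on the convex set $\mathcal O_2$ for each $x_1\in\mathcal X_1$ and $f_{2,i}(\cdot,x_2)$ is concave on $\mathcal X_1$ for each $x_2\in\mathcal X_2$; (iii) $f_{1,i}(\cdot,x_2)$ is $L_{1,1}$-Lipschitz on $\mathcal O_1$ for each $x_2\in\mathcal X_2$, $f_{1,i}(x_1,\cdot)$ is $L_{1,2}$-Lipschitz on $\mathcal X_2$ for each $x_1\in\mathcal X_1$, $f_{2,i}(x_1,\cdot)$ is $L_{2,1}$-Lipschitz on $\mathcal O_2$ for each $x_1\in\mathcal X_1$, and $f_{2,i}(\cdot,x_2)$ is $L_{2,2}$-Lipschitz on $\mathcal X_1$ for each $x_2\in\mathcal X_2$. **Assumption 2.** At times $k=0,1,\dots$ agents of $\Sigma_l$ communicate over a digraph $\mathcal G_l(k)$ on $\mathcal V_l$, and the two subnetworks over a bipartite digraph $\mathcal G_{12}(k)$ on $\mathcal V_1\sqcup\mathcal V_2$; $j$ is a neighbor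 of $i$ if $(j,i)$ is an edge. For $l=1,2$ there is $B_l\ge1$ such that $\bigcup_{t=k}^{k+B_l-1}\mathcal G_l(t)$ is strongly connected for all $k\ge0$; every agent is a neighbor of itself in $\mathcal G_l(k)$ and has at least one neighbor in the other subnetwork in $\mathcal G_{12}(k)$, for all $k$. There is $\eta\in(0,1)$ such that the weights satisfy: $w_{l,ij}(k)\ge\eta$ if $j$ is a neighbor of $i$ in $\mathcal G_l(k)$ and $w_{l,ij}(k)=0$ otherwise, and likewise for $w_{12,ij}(k)$ and $\mathcal G_{12}(k)$; $\sum_{j}w_{l,ij}(k)=\sum_{i}w_{l,ij}(k)=1$; and $\sum_{j\in\mathcal V_{3-l}}w_{12,ij}(k)=1$ for $i\in\mathcal V_l$. **Assumption 3.** For $l=1,2$, $\psi_l$ is continuously differentiable on $\mathcal X_l$ and, for some $\sigma_l>0$, $\psi_l(y)\ge\psi_l(x)+\langle\nabla\psi_l(x),y-x\rangle+\frac{\sigma_l}2\|x-y\|^2$ for all $x,y\in\mathcal X_l$. The Bregman divergence $D_{\psi_l}(x,y)=\psi_l(x)-\psi_l(y)-\langle\nabla\psi_l(y),x-y\rangle$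 on $\mathcal X_l\times\mathcal X_l$ is convex in $y$, and $x_k\to x$ in $\mathcal X_l$ implies $D_{\psi_l}(x_k,x)\to0$. **Assumption 4.** The step sizes $\alpha(t)$, $t\ge0$, are positive and non-increasing, $\sum_{t=0}^\infty\alpha(t)=\infty$ and $\sum_{t=0}^\infty\alpha^2(t)<\infty$. **Algorithm 1.** Start from arbitrary $x_{l,i}(0)\in\mathcal X_l$. For $t=0,1,\dots$ and $l=1,2$ put $$v_{l,i}(t)=\sum_{j\in\mathcal V_l}w_{l,ij}(t)x_{l,j}(t)\ (i\in\mathcal V_l),\qquad u_{l,i}(t)=\sum_{j\in\mathcal V_l}w_{12,ij}(t)x_{l,j}(t)\ (i\in\mathcal V_{3-l}),$$ choose arbitrary subgradients $g_{1,i}(t)\in\partial_1f_{1,i}(v_{1,i}(t),u_{2,i}(t))$ and $g_{2,i}(t)\in\partial_2f_{2,i}(u_{1,i}(t),v_{2,i}(t))$ (subdifferentials of the convex functions $f_{1,i}(\cdot,u_{2,i}(t))$ on $\mathcal O_1$ and $f_{2,i}(u_{1,i}(t),\cdot)$ on $\mathcal O_2$), and let $$x_{l,i}(t+1)=\arg\min_{x\in\mathcal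 X_l}\Big\{\langle g_{l,i}(t),x-v_{l,i}(t)\rangle+\tfrac1{\alpha(t)}D_{\psi_l}(x,v_{l,i}(t))\Big\}.$$ **Theorem 2.** Under Assumptions 1–4, suppose in addition that $U$ is strictly convex-concave on $\mathcal X_1\times\mathcal X_2$, i.e. strictly convex in $x_1$ for each $x_2$ and strictly concave in $x_2$ for each $x_1$. Then the game has a unique NE $(x_1^*,x_2^*)$, and every sequence generated by Algorithm 1 satisfies $$\lim_{t\to\infty}x_{1,i}(t)=x_1^*,\qquad\lim_{t\to\infty}x_{2,j}(t)=x_2^*\qquad\text{for all }i\in\mathcal V_1,\ j\in\mathcal V_2.$$ -/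

import Mathlib

open Filter Topology

/-- `ℝᵐ` with its standard inner product. -/
abbrev Vec (m : ℕ) : Type := EuclideanSpace ℝ (Fin m)

/-- The `l_p` norm of a vector of `ℝᵐ`. -/
noncomputable def lpNormVec {m : ℕ} (p : ENNReal) (x : Vec m) : ℝ :=
  ‖(WithLp.toLp p (WithLp.ofLp x) : PiLp p (fun _ : Fin m => ℝ))‖

/-- `f` is Lipschitz on `S` with constant `L` for the `l_p` norm. -/
def LipschitzOnLp {m : ℕ} (p : ENNReal) (L : ℝ) (S : Set (Vec m)) (f : Vec m → ℝ) : Prop :=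
  ∀ x ∈ S, ∀ y ∈ S, |f x - f y| ≤ L * lpNormVec p (x - y)

/-- The subdifferential at `v` of a function `f` with domain `O`. -/
def subdiff {m : ℕ} (O : Set (Vec m)) (f : Vec m → ℝ) (v : Vec m) : Set (Vec m) :=
  {g | ∀ y ∈ O, f v + inner ℝ g (y - v) ≤ f y}

/-- The data of a two-subnetwork game: `n₁` and `n₂` agents, action sets `X₁ ⊆ ℝ^{m₁}` and
`X₂ ⊆ ℝ^{m₂}`, and the agents' costs. The costs `f₁ i` of the first subnetwork are regarded as
functions on `O₁ × X₂`, the costs `f₂ i` of the second one as functions on `X₁ × O₂`, where `Oₗ` is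
a neighbourhood of `Xₗ` (see `GameAssumption`); other values are irrelevant. -/
structure SubnetworkGame (m₁ m₂ n₁ n₂ : ℕ) where
  X₁ : Set (Vec m₁)
  X₂ : Set (Vec m₂)
  O₁ : Set (Vec m₁)
  O₂ : Set (Vec m₂)
  f₁ : Fin n₁ → Vec m₁ → Vec m₂ → ℝ
  f₂ : Fin n₂ → Vec m₁ → Vec m₂ → ℝ

namespace SubnetworkGame

variable {m₁ m₂ n₁ n₂ : ℕ}

/-- The global cost of the first subnetwork: the average of its agents' costs. -/
noncomputable def cost₁ (G : SubnetworkGame m₁ m₂ n₁ n₂) (x₁ : Vec m₁) (x₂ : Vec m₂) : ℝ :=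
  (1 / (n₁ : ℝ)) * ∑ i, G.f₁ i x₁ x₂

/-- The global cost of the second subnetwork: the average of its agents' costs. -/
noncomputable def cost₂ (G : SubnetworkGame m₁ m₂ n₁ n₂) (x₁ : Vec m₁) (x₂ : Vec m₂) : ℝ :=
  (1 / (n₂ : ℝ)) * ∑ i, G.f₂ i x₁ x₂

/-- The cost function `U` of the zero-sum game. -/
noncomputable def U (G : SubnetworkGame m₁ m₂ n₁ n₂) : Vec m₁ → Vec m₂ → ℝ := G.cost₁

/-- The game is zero-sum. -/
def ZeroSum (G : SubnetworkGame m₁ m₂ n₁ n₂) : Prop :=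
  ∀ x₁ ∈ G.X₁, ∀ x₂ ∈ G.X₂, G.cost₁ x₁ x₂ + G.cost₂ x₁ x₂ = 0

/-- Nash equilibria of the zero-sum game. -/
def IsNash (G : SubnetworkGame m₁ m₂ n₁ n₂) (x₁ : Vec m₁) (x₂ : Vec m₂) : Prop :=
  x₁ ∈ G.X₁ ∧ x₂ ∈ G.X₂ ∧
    IsMinOn (fun y => G.U y x₂) G.X₁ x₁ ∧ IsMaxOn (fun y => G.U x₁ y) G.X₂ x₂

/-- `U` is strictly convex-concave on `X₁ × X₂`. -/
def StrictlyConvexConcave (G : SubnetworkGame m₁ m₂ n₁ n₂) : Prop :=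
  (∀ x₂ ∈ G.X₂, StrictConvexOn ℝ G.X₁ (fun x₁ => G.U x₁ x₂)) ∧
    (∀ x₁ ∈ G.X₁, StrictConcaveOn ℝ G.X₂ (fun x₂ => G.U x₁ x₂))

/-- Standing assumption on the action sets and on the costs: compactness and convexity of the
action sets, convexity-concavity and Lipschitz continuity of the costs. In the agent's own variable
the cost is convex and Lipschitz on an open neighbourhood `Oₗ` of `Xₗ`. -/
structure GameAssumption (G : SubnetworkGame m₁ m₂ n₁ n₂) (p₁ p₂ : ENNReal)
    (L₁₁ L₁₂ L₂₁ L₂₂ : ℝ) : Prop where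
  compact₁ : IsCompact G.X₁
  compact₂ : IsCompact G.X₂
  convex₁ : Convex ℝ G.X₁
  convex₂ : Convex ℝ G.X₂
  open₁ : IsOpen G.O₁
  open₂ : IsOpen G.O₂
  subset₁ : G.X₁ ⊆ G.O₁
  subset₂ : G.X₂ ⊆ G.O₂
  f₁_convex : ∀ i, ∀ x₂ ∈ G.X₂, ConvexOn ℝ G.O₁ (fun x₁ => G.f₁ i x₁ x₂)
  f₁_concave : ∀ i, ∀ x₁ ∈ G.X₁, ConcaveOn ℝ G.X₂ (fun x₂ => G.f₁ i x₁ x₂)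
  f₂_concave : ∀ i, ∀ x₂ ∈ G.X₂, ConcaveOn ℝ G.X₁ (fun x₁ => G.f₂ i x₁ x₂)
  f₂_convex : ∀ i, ∀ x₁ ∈ G.X₁, ConvexOn ℝ G.O₂ (fun x₂ => G.f₂ i x₁ x₂)
  f₁_lip₁ : ∀ i, ∀ x₂ ∈ G.X₂, LipschitzOnLp p₁ L₁₁ G.O₁ (fun x₁ => G.f₁ i x₁ x₂)
  f₁_lip₂ : ∀ i, ∀ x₁ ∈ G.X₁, LipschitzOnLp p₂ L₁₂ G.X₂ (fun x₂ => G.f₁ i x₁ x₂)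
  f₂_lip₂ : ∀ i, ∀ x₁ ∈ G.X₁, LipschitzOnLp p₂ L₂₁ G.O₂ (fun x₂ => G.f₂ i x₁ x₂)
  f₂_lip₁ : ∀ i, ∀ x₂ ∈ G.X₂, LipschitzOnLp p₁ L₂₂ G.X₁ (fun x₁ => G.f₂ i x₁ x₂)

end SubnetworkGame

/-- A digraph is strongly connected if every node can be reached from every other one. -/
def StronglyConnected {V : Type*} (G : Digraph V) : Prop :=
  ∀ i j : V, i ≠ j → Relation.TransGen G.Adj i j

/-- The sequence `G k` is uniformly jointly strongly connected: for some `B ≥ 1`, each union of `B`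
consecutive graphs is strongly connected. -/
def UniformlyJointlyStronglyConnected {V : Type*} (G : ℕ → Digraph V) : Prop :=
  ∃ B : ℕ, 0 < B ∧ ∀ k : ℕ,
    StronglyConnected (Digraph.mk fun a b => ∃ t, k ≤ t ∧ t ≤ k + B - 1 ∧ (G t).Adj a b)

/-- Communication networks and weights. `(G₁ k).Adj j i` means that agent `i` receives information
from agent `j` at time `k`; the weight that `i` gives to `j` is `W₁ k i j`. Likewise for `G₂`, `W₂`
and for the bipartite graphs `G₁₂ k` and their weights `W₁₂ k`. -/
structure CommNetwork (n₁ n₂ : ℕ) where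
  G₁ : ℕ → Digraph (Fin n₁)
  G₂ : ℕ → Digraph (Fin n₂)
  G₁₂ : ℕ → Digraph (Fin n₁ ⊕ Fin n₂)
  W₁ : ℕ → Matrix (Fin n₁) (Fin n₁) ℝ
  W₂ : ℕ → Matrix (Fin n₂) (Fin n₂) ℝ
  W₁₂ : ℕ → Matrix (Fin n₁ ⊕ Fin n₂) (Fin n₁ ⊕ Fin n₂) ℝ

/-- The weights `W k` are adapted to the graphs `G k`, with lower bound `η` on the edges. -/
def WeightsAdapted {V : Type*} (η : ℝ) (G : ℕ → Digraph V) (W : ℕ → Matrix V V ℝ) : Prop :=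
  ∀ k i j, ((G k).Adj j i → η ≤ W k i j) ∧ (¬ (G k).Adj j i → W k i j = 0)

/-- Standing assumption on the communication networks. -/
structure CommNetwork.NetworkAssumption {n₁ n₂ : ℕ} (N : CommNetwork n₁ n₂) (η : ℝ) : Prop where
  connected₁ : UniformlyJointlyStronglyConnected N.G₁
  connected₂ : UniformlyJointlyStronglyConnected N.G₂
  /-- every agent uses its own estimate -/
  self₁ : ∀ k i, (N.G₁ k).Adj i i
  self₂ : ∀ k i, (N.G₂ k).Adj i i
  /-- `G₁₂ k` is bipartite -/
  bipartite₁ : ∀ k (i j : Fin n₁), ¬ (N.G₁₂ k).Adj (Sum.inl i) (Sum.inl j)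
  bipartite₂ : ∀ k (i j : Fin n₂), ¬ (N.G₁₂ k).Adj (Sum.inr i) (Sum.inr j)
  /-- every agent has a neighbor in the other subnetwork -/
  cross₁ : ∀ k (i : Fin n₁), ∃ j : Fin n₂, (N.G₁₂ k).Adj (Sum.inr j) (Sum.inl i)
  cross₂ : ∀ k (i : Fin n₂), ∃ j : Fin n₁, (N.G₁₂ k).Adj (Sum.inl j) (Sum.inr i)
  eta_pos : 0 < η
  eta_lt_one : η < 1
  weights₁ : WeightsAdapted η N.G₁ N.W₁
  weights₂ : WeightsAdapted η N.G₂ N.W₂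
  weights₁₂ : WeightsAdapted η N.G₁₂ N.W₁₂
  row_sum₁ : ∀ k i, ∑ j, N.W₁ k i j = 1
  col_sum₁ : ∀ k j, ∑ i, N.W₁ k i j = 1
  row_sum₂ : ∀ k i, ∑ j, N.W₂ k i j = 1
  col_sum₂ : ∀ k j, ∑ i, N.W₂ k i j = 1
  cross_sum₁ : ∀ k (i : Fin n₁), ∑ j : Fin n₂, N.W₁₂ k (Sum.inl i) (Sum.inr j) = 1
  cross_sum₂ : ∀ k (i : Fin n₂), ∑ j : Fin n₁, N.W₁₂ k (Sum.inr i) (Sum.inl j) = 1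

/-- `ψ` is a continuously differentiable, `σ`-strongly convex function on `X`, for the `l_p` norm. -/
structure IsRegularizer {m : ℕ} (p : ENNReal) (σ : ℝ) (X : Set (Vec m)) (ψ : Vec m → ℝ) :
    Prop where
  sigma_pos : 0 < σ
  differentiable : ∀ x ∈ X, DifferentiableAt ℝ ψ x
  gradient_continuous : ContinuousOn (gradient ψ) X
  strongly_convex : ∀ x ∈ X, ∀ y ∈ X,
    ψ x + inner ℝ (gradient ψ x) (y - x) + σ / 2 * lpNormVec p (x - y) ^ 2 ≤ ψ y

/-- The Bregman divergence of `ψ`. -/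
noncomputable def bregman {m : ℕ} (ψ : Vec m → ℝ) (x y : Vec m) : ℝ :=
  ψ x - ψ y - inner ℝ (gradient ψ y) (x - y)

/-- Standing assumption on the Bregman divergence: convexity in the second argument, and
reciprocity. -/
structure BregmanAssumption {m : ℕ} (X : Set (Vec m)) (ψ : Vec m → ℝ) : Prop where
  convex_right : ∀ x ∈ X, ConvexOn ℝ X (fun y => bregman ψ x y)
  reciprocity : ∀ x ∈ X, ∀ s : ℕ → Vec m, (∀ k, s k ∈ X) →
    Tendsto s atTop (𝓝 x) → Tendsto (fun k => bregman ψ (s k) x) atTop (𝓝 0)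

/-- `x⁺` is a minimizer over `X` of `⟨g, x - v⟩ + D_ψ(x, v) / a`. -/
def MirrorStep {m : ℕ} (X : Set (Vec m)) (ψ : Vec m → ℝ) (a : ℝ) (g v xnext : Vec m) : Prop :=
  xnext ∈ X ∧ IsMinOn (fun x => inner ℝ g (x - v) + 1 / a * bregman ψ x v) X xnext

section Algorithm

variable {m₁ m₂ n₁ n₂ : ℕ}

/-- Weighted average of the estimates of an agent's own subnetwork, with weight matrix `W`. The sum
may run over all agents because the weight of a non-neighbor is zero. -/
noncomputable def ownAverage {m n : ℕ} (W : Matrix (Fin n) (Fin n) ℝ) (x : Fin n → Vec m)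
    (i : Fin n) : Vec m :=
  ∑ j, W i j • x j

/-- The estimate of the second subnetwork's action formed by agent `i` of the first one. -/
noncomputable def crossAverage₂ (W : Matrix (Fin n₁ ⊕ Fin n₂) (Fin n₁ ⊕ Fin n₂) ℝ)
    (x₂ : Fin n₂ → Vec m₂) (i : Fin n₁) : Vec m₂ :=
  ∑ j, W (Sum.inl i) (Sum.inr j) • x₂ j

/-- The estimate of the first subnetwork's action formed by agent `i` of the second one. -/
noncomputable def crossAverage₁ (W : Matrix (Fin n₁ ⊕ Fin n₂) (Fin n₁ ⊕ Fin n₂) ℝ)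
    (x₁ : Fin n₁ → Vec m₁) (i : Fin n₂) : Vec m₁ :=
  ∑ j, W (Sum.inr i) (Sum.inl j) • x₁ j

/-- `x₁`, `x₂` are the sequences of estimates, and `g₁`, `g₂` the sequences of subgradients, of a
run of the distributed mirror descent algorithm with step sizes `α`. -/
structure IsRun (G : SubnetworkGame m₁ m₂ n₁ n₂) (N : CommNetwork n₁ n₂)
    (ψ₁ : Vec m₁ → ℝ) (ψ₂ : Vec m₂ → ℝ) (α : ℕ → ℝ)
    (x₁ g₁ : ℕ → Fin n₁ → Vec m₁) (x₂ g₂ : ℕ → Fin n₂ → Vec m₂) : Prop where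
  init₁ : ∀ i, x₁ 0 i ∈ G.X₁
  init₂ : ∀ i, x₂ 0 i ∈ G.X₂
  subgradient₁ : ∀ t i, g₁ t i ∈
    subdiff G.O₁ (fun y => G.f₁ i y (crossAverage₂ (N.W₁₂ t) (x₂ t) i))
      (ownAverage (N.W₁ t) (x₁ t) i)
  subgradient₂ : ∀ t i, g₂ t i ∈
    subdiff G.O₂ (fun y => G.f₂ i (crossAverage₁ (N.W₁₂ t) (x₁ t) i) y)
      (ownAverage (N.W₂ t) (x₂ t) i)
  update₁ : ∀ t i,
    MirrorStep G.X₁ ψ₁ (α t) (g₁ t i) (ownAverage (N.W₁ t) (x₁ t) i) (x₁ (t + 1) i)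
  update₂ : ∀ t i,
    MirrorStep G.X₂ ψ₂ (α t) (g₂ t i) (ownAverage (N.W₂ t) (x₂ t) i) (x₂ (t + 1) i)

end Algorithm

/-! The proof is a Lyapunov argument for `totalDivergence`, the mean Bregman divergence of the
estimates from a fixed pair `(z₁, z₂)`. A mirror step from `v` changes the divergence from `z` by at
most `α (f z - f v) + O(α²)` (`MirrorStep.bregman_le`). Averaging with doubly stochastic weights
does not increase the total, since the divergence is convex in its second argument. Evaluating the
costs at the network means `y₁`, `y₂` instead costs `O(α d)`, with `d` the sum of the diameters of
the two sets of estimates. When the two subnetworks are added, zero-sum cancels `U y₁ y₂` and leaves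
a decrease by `α (U y₁ z₂ - U z₁ y₂)`, up to an error independent of `(z₁, z₂)`
(`IsRun.exists_totalDivergence_le`).

The errors are summable: mirror steps have length `O(α)`, so the estimates follow a perturbed
consensus iteration. Products of the weight matrices over a fixed window are uniformly positive and
contract the diameter, whence `∑ α d < ∞` (`summable_mul_diam_range`).

For arbitrary `(z₁, z₂)` the inequality telescopes to a bound on the weighted regret, and as `∑ α =
∞`, limit points of the weighted averages are saddle points. This gives existence without a minimax
theorem. At an equilibrium the gap is nonnegative and `∑ α gap < ∞`, so gap and diameters vanish
along a subsequence. Strictness identifies its limit with the equilibrium; there the divergence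
tends to zero, and near-monotonicity extends this to the whole sequence. -/

/-! ### Perturbed consensus over time-varying digraphs -/

section Consensus

variable {ι E : Type*} [Fintype ι] [NormedAddCommGroup E] [NormedSpace ℝ E]

/-- Two convex combinations of the same points whose first weights are bounded below by `δ` are at
distance at most `(1 - δ)` times the diameter. -/
theorem norm_sum_smul_sub_sum_smul_le {a b : ι → ℝ} (ha : ∀ k, 0 ≤ a k) (hb : ∀ k, 0 ≤ b k)
    (ha1 : ∑ k, a k = 1) (hb1 : ∑ k, b k = 1) {δ : ℝ} (hδ : ∀ k, δ ≤ a k) (x : ι → E) :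
    ‖∑ k, a k • x k - ∑ k, b k • x k‖ ≤ (1 - δ) * Metric.diam (Set.range x) := by
  classical
  set D := Metric.diam (Set.range x)
  have hD : ∀ k l, ‖x k - x l‖ ≤ D := fun k l => by
    rw [← dist_eq_norm]
    exact Metric.dist_le_diam_of_mem (Set.finite_range x).isBounded ⟨k, rfl⟩ ⟨l, rfl⟩
  have hD0 : 0 ≤ D := Metric.diam_nonneg
  -- Product coupling of the two weight vectors: the diagonal terms vanish, and they carry mass `∑ a
  -- k * b k ≥ δ`.
  have h1 : ∑ k, a k • x k - ∑ k, b k • x k = ∑ k, ∑ l, (a k * b l) • (x k - x l) := by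
    have e1 : ∑ k, ∑ l, (a k * b l) • x k = ∑ k, a k • x k := by
      refine Finset.sum_congr rfl fun k _ => ?_
      rw [← Finset.sum_smul, ← Finset.mul_sum, hb1, mul_one]
    have e2 : ∑ k, ∑ l, (a k * b l) • x l = ∑ l, b l • x l := by
      rw [Finset.sum_comm]
      refine Finset.sum_congr rfl fun l _ => ?_
      rw [← Finset.sum_smul, ← Finset.sum_mul, ha1, one_mul]
    simp only [smul_sub, Finset.sum_sub_distrib, e1, e2]
  have h2 : ∀ k l, ‖(a k * b l) • (x k - x l)‖ ≤
      a k * b l * D - if k = l then a k * b l * D else 0 := by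
    intro k l
    have h0 := mul_nonneg (ha k) (hb l)
    split_ifs with h
    · simp [h]
    · rw [norm_smul, Real.norm_of_nonneg h0, sub_zero]
      exact mul_le_mul_of_nonneg_left (hD k l) h0
  have h3 : ∑ k, ∑ l, (a k * b l * D - if k = l then a k * b l * D else 0)
      = D - (∑ k, a k * b k) * D := by
    simp only [Finset.sum_sub_distrib, Finset.sum_ite_eq, Finset.mem_univ, if_true]
    simp only [← Finset.sum_mul, ← Finset.mul_sum, hb1, ha1, mul_one, one_mul]
  have h4 : δ ≤ ∑ k, a k * b k := by
    calc δ = ∑ k, δ * b k := by rw [← Finset.mul_sum, hb1, mul_one]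
      _ ≤ _ := Finset.sum_le_sum fun k _ => mul_le_mul_of_nonneg_right (hδ k) (hb k)
  calc _ ≤ ∑ k, ∑ l, ‖(a k * b l) • (x k - x l)‖ := by
        rw [h1]
        exact (norm_sum_le _ _).trans (Finset.sum_le_sum fun k _ => norm_sum_le _ _)
    _ ≤ _ := Finset.sum_le_sum fun k _ => Finset.sum_le_sum fun l _ => h2 k l
    _ = D - (∑ k, a k * b k) * D := h3
    _ ≤ _ := by nlinarith

/-- The transition matrix `W (s + k - 1) ⋯ W s`. -/
def transition [DecidableEq ι] (W : ℕ → Matrix ι ι ℝ) (s : ℕ) : ℕ → Matrix ι ι ℝ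
  | 0 => 1
  | k + 1 => W (s + k) * transition W s k

variable [DecidableEq ι] {W : ℕ → Matrix ι ι ℝ}

theorem transition_nonneg (hnn : ∀ t i j, 0 ≤ W t i j) (s k : ℕ) (i j : ι) :
    0 ≤ transition W s k i j := by
  induction k generalizing i j with
  | zero => simp only [transition, Matrix.one_apply]; split_ifs <;> norm_num
  | succ k ih => exact Finset.sum_nonneg fun l _ => mul_nonneg (hnn _ _ _) (ih _ _)

theorem transition_row_sum (hrow : ∀ t i, ∑ j, W t i j = 1) (s k : ℕ) (i : ι) :
    ∑ j, transition W s k i j = 1 := by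
  induction k generalizing i with
  | zero => simp [transition, Matrix.one_apply]
  | succ k ih =>
    simp only [transition, Matrix.mul_apply]
    rw [Finset.sum_comm]
    simp only [← Finset.mul_sum, ih, mul_one, hrow]

/-- Extending a path by one edge costs one factor `η`; nonnegativity allows all other paths to be
dropped. -/
theorem le_transition_succ (hnn : ∀ t i j, 0 ≤ W t i j) {η : ℝ} (hη : 0 ≤ η) {s k : ℕ} {i l j : ι}
    (hW : η ≤ W (s + k) i l) (h : η ^ k ≤ transition W s k l j) :
    η ^ (k + 1) ≤ transition W s (k + 1) i j := by
  calc η ^ (k + 1) = η * η ^ k := pow_succ' _ _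
    _ ≤ W (s + k) i l * transition W s k l j := mul_le_mul hW h (pow_nonneg hη _) (hnn _ _ _)
    _ ≤ _ := Finset.single_le_sum (f := fun l => W (s + k) i l * transition W s k l j)
        (fun l _ => mul_nonneg (hnn _ _ _) (transition_nonneg hnn _ _ _ _)) (Finset.mem_univ l)

/-- In a strongly connected digraph an edge leaves every proper nonempty set of nodes. -/
theorem StronglyConnected.exists_adj_of_mem_of_notMem {V : Type*} {G : Digraph V}
    (hG : StronglyConnected G) {R : Set V} {a b : V} (ha : a ∈ R) (hb : b ∉ R) :
    ∃ u ∈ R, ∃ v ∉ R, G.Adj u v := by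
  by_contra! h
  have : ∀ c, Relation.TransGen G.Adj a c → c ∈ R := by
    intro c hc
    induction hc with
    | single hab => by_contra hc; exact h _ ha _ hc hab
    | tail _ hbc ih => by_contra hc; exact h _ ih _ hc hbc
  exact hb (this b (hG a b (by rintro rfl; exact hb ha)))

/-- Uniform joint strong connectivity makes the transition matrices over windows of a fixed length
uniformly positive. -/
theorem exists_le_transition {G : ℕ → Digraph ι} (hG : UniformlyJointlyStronglyConnected G)
    {η : ℝ} (hη : 0 < η) (hnn : ∀ t i j, 0 ≤ W t i j) (hself : ∀ t i, η ≤ W t i i)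
    (hedge : ∀ t i j, (G t).Adj j i → η ≤ W t i j) :
    ∃ T : ℕ, ∃ δ : ℝ, 0 < δ ∧ ∀ s i j, δ ≤ transition W s T i j := by
  classical
  obtain ⟨B, hB, hconn⟩ := hG
  refine ⟨Fintype.card ι * B, η ^ (Fintype.card ι * B), pow_pos hη _, fun s i j => ?_⟩
  -- `R k` collects agents that the information of `j` has reached after `k` steps. Self-loops make
  -- it grow with `k`, and joint connectivity adds an agent in every `B` steps until it is
  -- everything.
  set R : ℕ → Finset ι := fun k => Finset.univ.filter fun i => η ^ k ≤ transition W s k i j with hR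
  have hstep : ∀ k, R k ⊆ R (k + 1) := fun k i hi => by
    simp only [hR, Finset.mem_filter, Finset.mem_univ, true_and] at hi ⊢
    exact le_transition_succ hnn hη.le (hself _ _) hi
  have hmono : Monotone R := monotone_nat_of_le_succ hstep
  have hj : ∀ k, j ∈ R k := fun k => hmono (Nat.zero_le k) (by simp [hR, transition])
  have hgrow : ∀ k, R k ≠ Finset.univ → (R k).card + 1 ≤ (R (k + B)).card := by
    intro k hk
    obtain ⟨b, hb⟩ : ∃ b, b ∉ R k := by
      by_contra! h
      exact hk (Finset.eq_univ_iff_forall.2 h)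
    obtain ⟨u, hu, v, hv, t, ht1, ht2, huv⟩ :=
      (hconn (s + k)).exists_adj_of_mem_of_notMem (R := (R k : Set ι)) (hj k) hb
    obtain ⟨r, rfl⟩ := Nat.exists_eq_add_of_le ht1
    have hu' : u ∈ R (k + r) := hmono (Nat.le_add_right _ _) hu
    -- The edge is used at time `s + k + r` with `r ≤ B - 1`, so `v` is reached by step `k + B` at
    -- the latest.
    have hv' : v ∈ R (k + r + 1) := by
      simp only [hR, Finset.mem_filter, Finset.mem_univ, true_and] at hu' ⊢
      refine le_transition_succ hnn hη.le (hedge _ _ _ ?_) hu'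
      rwa [← add_assoc]
    exact Finset.card_lt_card ((Finset.ssubset_iff_of_subset (hmono (Nat.le_add_right _ _))).2
      ⟨v, hmono (by omega) hv', hv⟩)
  have hcard : ∀ q, q ≤ Fintype.card ι → q ≤ (R (q * B)).card := by
    intro q
    induction q with
    | zero => simp
    | succ q ih =>
      intro hq
      have h1 := ih (by omega)
      rw [Nat.succ_mul]
      by_cases hu : R (q * B) = Finset.univ
      · have : R (q * B + B) = Finset.univ := Finset.eq_univ_iff_forall.2 fun i =>
          hmono (Nat.le_add_right _ _) (hu ▸ Finset.mem_univ i)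
        rw [this, Finset.card_univ]
        exact hq
      · have := hgrow _ hu
        omega
  have huniv : R (Fintype.card ι * B) = Finset.univ :=
    (Finset.card_eq_iff_eq_univ _).1 (le_antisymm (Finset.card_le_univ _) (hcard _ le_rfl))
  have hi : i ∈ R (Fintype.card ι * B) := huniv ▸ Finset.mem_univ i
  simpa [hR] using hi

/-- Contribution of the perturbations to a perturbed consensus iteration. -/
theorem norm_sub_transition_le (hnn : ∀ t i j, 0 ≤ W t i j) (hrow : ∀ t i, ∑ j, W t i j = 1)
    {x : ℕ → ι → E} {e : ℕ → ℝ} (hx : ∀ t i, ‖x (t + 1) i - ∑ j, W t i j • x t j‖ ≤ e t)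
    (s k : ℕ) (i : ι) :
    ‖x (s + k) i - ∑ j, transition W s k i j • x s j‖ ≤ ∑ r ∈ Finset.range k, e (s + r) := by
  induction k generalizing i with
  | zero => simp [transition, Matrix.one_apply]
  | succ k ih =>
    have h1 : ∑ j, transition W s (k + 1) i j • x s j
        = ∑ l, W (s + k) i l • ∑ j, transition W s k l j • x s j := by
      simp only [transition, Matrix.mul_apply, Finset.sum_smul, Finset.smul_sum, mul_smul]
      rw [Finset.sum_comm]
    have h2 : x (s + (k + 1)) i - ∑ j, transition W s (k + 1) i j • x s j
        = (x (s + k + 1) i - ∑ l, W (s + k) i l • x (s + k) l)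
          + ∑ l, W (s + k) i l • (x (s + k) l - ∑ j, transition W s k l j • x s j) := by
      rw [h1]
      simp only [smul_sub, Finset.sum_sub_distrib, add_assoc]
      abel
    rw [h2, Finset.sum_range_succ]
    refine (norm_add_le _ _).trans ((add_le_add (hx _ _) ?_).trans_eq (add_comm _ _))
    calc _ ≤ ∑ l, W (s + k) i l * ∑ r ∈ Finset.range k, e (s + r) := by
          refine norm_sum_le_of_le _ fun l _ => ?_
          rw [norm_smul, Real.norm_of_nonneg (hnn _ _ _)]
          exact mul_le_mul_of_nonneg_left (ih l) (hnn _ _ _)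
      _ = _ := by rw [← Finset.sum_mul, hrow, one_mul]

/-- A perturbed consensus iteration over uniformly jointly strongly connected digraphs: if the
perturbations are `O(α t)` with `α` square summable, then the disagreement is summable against
`α`. -/
theorem summable_mul_diam_range {G : ℕ → Digraph ι} (hG : UniformlyJointlyStronglyConnected G)
    {η : ℝ} (hη : 0 < η) (hnn : ∀ t i j, 0 ≤ W t i j) (hself : ∀ t i, η ≤ W t i i)
    (hedge : ∀ t i j, (G t).Adj j i → η ≤ W t i j) (hrow : ∀ t i, ∑ j, W t i j = 1)
    {α : ℕ → ℝ} (hα : ∀ t, 0 ≤ α t) (hα_mono : Antitone α) (hα_sq : Summable fun t => α t ^ 2)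
    {x : ℕ → ι → E} {K : ℝ} (hK : 0 ≤ K)
    (hx : ∀ t i, ‖x (t + 1) i - ∑ j, W t i j • x t j‖ ≤ K * α t) :
    Summable fun t => α t * Metric.diam (Set.range (x t)) := by
  obtain ⟨T, δ, hδ, hT⟩ := exists_le_transition hG hη hnn hself hedge
  set d : ℕ → ℝ := fun t => Metric.diam (Set.range (x t)) with hd
  have hd0 : ∀ t, 0 ≤ d t := fun t => Metric.diam_nonneg
  rcases isEmpty_or_nonempty ι with hι | hι
  · have : ∀ t, d t = 0 := fun t => by simp [hd, Set.range_eq_empty]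
    change Summable fun t => α t * d t
    simp only [this, mul_zero]
    exact summable_zero
  have hδ1 : δ ≤ 1 := by
    obtain ⟨i⟩ := hι
    refine (hT 0 i i).trans ?_
    rw [← transition_row_sum hrow 0 T i]
    exact Finset.single_le_sum (f := fun j => transition W 0 T i j)
      (fun j _ => transition_nonneg hnn _ _ _ _) (Finset.mem_univ i)
  -- Two agents are compared, and each collects `T` perturbations of size at most `K * α s`, as `α`
  -- is antitone.
  set K' := 2 * (T * K)
  have hK' : 0 ≤ K' := by positivity
  have hrec : ∀ s, d (s + T) ≤ (1 - δ) * d s + K' * α s := by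
    intro s
    have herr : ∑ r ∈ Finset.range T, K * α (s + r) ≤ T * K * α s := by
      calc _ ≤ ∑ r ∈ Finset.range T, K * α s := Finset.sum_le_sum fun r _ =>
            mul_le_mul_of_nonneg_left (hα_mono (Nat.le_add_right _ _)) hK
        _ = _ := by simp [mul_assoc]
    have h0 : 0 ≤ (1 - δ) * d s + K' * α s :=
      add_nonneg (mul_nonneg (by linarith) (hd0 s)) (mul_nonneg hK' (hα s))
    refine Metric.diam_le_of_forall_dist_le h0 ?_
    rintro _ ⟨i, rfl⟩ _ ⟨j, rfl⟩
    rw [dist_eq_norm]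
    have h1 := (norm_sub_transition_le hnn hrow hx s T i).trans herr
    have h2 := (norm_sub_transition_le hnn hrow hx s T j).trans herr
    have h3 := norm_sum_smul_sub_sum_smul_le (transition_nonneg hnn s T i)
      (transition_nonneg hnn s T j) (transition_row_sum hrow s T i) (transition_row_sum hrow s T j)
      (hT s i) (x s)
    rw [norm_sub_rev] at h2
    have h4 : x (s + T) i - x (s + T) j = (x (s + T) i - ∑ l, transition W s T i l • x s l)
        + (∑ l, transition W s T i l • x s l - ∑ l, transition W s T j l • x s l)
        + (∑ l, transition W s T j l • x s l - x (s + T) j) := by abel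
    rw [h4]
    refine (norm_add₃_le).trans ?_
    simp only [hd, K']
    linarith
  have hrec' : ∀ s, α (s + T) * d (s + T) ≤ (1 - δ) * (α s * d s) + K' * α s ^ 2 := by
    intro s
    calc _ ≤ α s * ((1 - δ) * d s + K' * α s) :=
          mul_le_mul (hα_mono (Nat.le_add_right _ _)) (hrec s) (hd0 _) (hα _)
      _ = _ := by ring
  -- Summing `hrec'` and bounding the first `T` terms separately puts `1 - δ` times the partial sum
  -- on the right; absorbing it leaves the factor `δ`.
  refine summable_of_sum_range_le
    (c := (∑ s ∈ Finset.range T, α s * d s + K' * ∑' s, α s ^ 2) / δ)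
    (fun t => mul_nonneg (hα t) (hd0 t)) fun N => ?_
  rw [le_div_iff₀ hδ]
  have h1 : ∑ s ∈ Finset.range N, α (s + T) * d (s + T)
      ≤ (1 - δ) * ∑ s ∈ Finset.range N, α s * d s + K' * ∑' s, α s ^ 2 := by
    calc _ ≤ ∑ s ∈ Finset.range N, ((1 - δ) * (α s * d s) + K' * α s ^ 2) :=
          Finset.sum_le_sum fun s _ => hrec' s
      _ = (1 - δ) * ∑ s ∈ Finset.range N, α s * d s
          + K' * ∑ s ∈ Finset.range N, α s ^ 2 := by
          rw [Finset.sum_add_distrib, Finset.mul_sum, Finset.mul_sum]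
      _ ≤ _ := by
          have := hα_sq.sum_le_tsum (Finset.range N) fun s _ => sq_nonneg _
          gcongr
  have h2 : ∑ s ∈ Finset.range N, α s * d s
      ≤ ∑ s ∈ Finset.range T, α s * d s + ∑ s ∈ Finset.range N, α (s + T) * d (s + T) := by
    have : ∑ s ∈ Finset.range N, α (s + T) * d (s + T)
        = ∑ s ∈ Finset.range N, α (T + s) * d (T + s) := by simp only [add_comm T]
    rw [this, ← Finset.sum_range_add (fun s => α s * d s)]
    exact Finset.sum_le_sum_of_subset_of_nonneg (Finset.range_mono (by omega))
      fun t _ _ => mul_nonneg (hα t) (hd0 t)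
  change (∑ s ∈ Finset.range N, α s * d s) * δ ≤ _
  linarith

end Consensus

/-! ### Bregman divergences, mirror steps and the progress of one subnetwork -/

section MirrorDescent

/-- The `l_p` norm and the Euclidean norm are equivalent. -/
theorem exists_lpNormVec_bounds {m : ℕ} {p : ENNReal} (hp : 1 ≤ p) :
    ∃ C : ℝ, 0 < C ∧ ∀ x : Vec m, lpNormVec p x ≤ C * ‖x‖ ∧ ‖x‖ ≤ C * lpNormVec p x := by
  have : Fact (1 ≤ p) := ⟨hp⟩
  let e : Vec m ≃L[ℝ] PiLp p (fun _ : Fin m => ℝ) :=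
    (PiLp.continuousLinearEquiv 2 ℝ (fun _ : Fin m => ℝ)).trans
      (PiLp.continuousLinearEquiv p ℝ (fun _ : Fin m => ℝ)).symm
  have he : ∀ x, lpNormVec p x = ‖e x‖ := fun x => rfl
  set A := ‖(e : Vec m →L[ℝ] PiLp p (fun _ : Fin m => ℝ))‖
  set B := ‖(e.symm : PiLp p (fun _ : Fin m => ℝ) →L[ℝ] Vec m)‖
  have hA : 0 ≤ A := norm_nonneg _
  have hB : 0 ≤ B := norm_nonneg _
  refine ⟨A + B + 1, by linarith, fun x => ?_⟩
  have h1 : ‖e x‖ ≤ A * ‖x‖ :=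
    (e : Vec m →L[ℝ] PiLp p (fun _ : Fin m => ℝ)).le_opNorm x
  have h2 : ‖x‖ ≤ B * ‖e x‖ := by
    simpa using (e.symm : PiLp p (fun _ : Fin m => ℝ) →L[ℝ] Vec m).le_opNorm (e x)
  rw [he]
  have h3 := norm_nonneg x
  have h4 := norm_nonneg (e x)
  constructor
  · nlinarith
  · nlinarith

/-- `L'` is chosen before `S` and `f`, so that one Euclidean constant serves all agents and all
opponent actions. -/
theorem exists_lipschitz_of_lipschitzOnLp (m : ℕ) {p : ENNReal} (hp : 1 ≤ p) (L : ℝ) :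
    ∃ L' : ℝ, 0 ≤ L' ∧ ∀ (S : Set (Vec m)) (f : Vec m → ℝ), LipschitzOnLp p L S f →
      ∀ x ∈ S, ∀ y ∈ S, |f x - f y| ≤ L' * ‖x - y‖ := by
  obtain ⟨C, hC, h⟩ := exists_lpNormVec_bounds (m := m) hp
  refine ⟨|L| * C, by positivity, fun S f hf x hx y hy => (hf x hx y hy).trans ?_⟩
  have h0 : 0 ≤ lpNormVec p (x - y) := by
    have h1 := (h (x - y)).2
    have h2 := norm_nonneg (x - y)
    by_contra! hneg
    nlinarith
  calc L * lpNormVec p (x - y) ≤ |L| * lpNormVec p (x - y) :=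
        mul_le_mul_of_nonneg_right (le_abs_self L) h0
    _ ≤ |L| * (C * ‖x - y‖) := mul_le_mul_of_nonneg_left (h _).1 (abs_nonneg L)
    _ = _ := by ring

theorem LipschitzOnLp.continuousOn {m : ℕ} {p : ENNReal} (hp : 1 ≤ p) {L : ℝ} {S : Set (Vec m)}
    {f : Vec m → ℝ} (hf : LipschitzOnLp p L S f) : ContinuousOn f S := by
  obtain ⟨L', hL', h⟩ := exists_lipschitz_of_lipschitzOnLp m hp L
  refine LipschitzOnWith.continuousOn (K := L'.toNNReal) (LipschitzOnWith.of_dist_le_mul ?_)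
  intro x hx y hy
  rw [Real.dist_eq, dist_eq_norm, Real.coe_toNNReal _ hL']
  exact h S f hf x hx y hy

/-- Strong convexity for the `l_p` norm gives a quadratic lower bound on the Bregman divergence. -/
theorem IsRegularizer.exists_le_bregman {m : ℕ} {p : ENNReal} (hp : 1 ≤ p) {σ : ℝ}
    {X : Set (Vec m)} {ψ : Vec m → ℝ} (hψ : IsRegularizer p σ X ψ) :
    ∃ c : ℝ, 0 < c ∧ ∀ x ∈ X, ∀ y ∈ X, c * ‖x - y‖ ^ 2 ≤ bregman ψ x y := by
  obtain ⟨C, hC, h⟩ := exists_lpNormVec_bounds (m := m) hp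
  have hσ := hψ.sigma_pos
  refine ⟨σ / 2 / C ^ 2, by positivity, fun x hx y hy => ?_⟩
  have h1 := hψ.strongly_convex y hy x hx
  have h2 := (h (y - x)).2
  rw [norm_sub_rev] at h2
  have h3 : ‖x - y‖ ^ 2 ≤ C ^ 2 * lpNormVec p (y - x) ^ 2 := by
    rw [← mul_pow]
    exact pow_le_pow_left₀ (norm_nonneg _) h2 2
  have h4 : σ / 2 / C ^ 2 * ‖x - y‖ ^ 2 ≤ σ / 2 * lpNormVec p (y - x) ^ 2 := by
    rw [div_mul_eq_mul_div, div_le_iff₀ (by positivity)]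
    nlinarith
  unfold bregman
  linarith

/-- Subgradients at interior points of a Lipschitz function are bounded by the Lipschitz
constant. -/
theorem norm_le_of_mem_subdiff {m : ℕ} {O : Set (Vec m)} (hO : IsOpen O) {f : Vec m → ℝ} {L : ℝ}
    (hf : ∀ x ∈ O, ∀ y ∈ O, |f x - f y| ≤ L * ‖x - y‖) {v g : Vec m} (hv : v ∈ O)
    (hg : g ∈ subdiff O f v) (hL : 0 ≤ L) : ‖g‖ ≤ L := by
  rcases eq_or_ne g 0 with rfl | hg0
  · simpa using hL
  -- The subgradient inequality is tested at `v + s • g`, which lies in `O` for small `s > 0`; it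
  -- gives `s ‖g‖² ≤ L s ‖g‖`.
  have hcont : Tendsto (fun s : ℝ => v + s • g) (𝓝[>] 0) (𝓝 v) := by
    have : Continuous fun s : ℝ => v + s • g := by fun_prop
    simpa using (this.tendsto 0).mono_left nhdsWithin_le_nhds
  obtain ⟨s, hsO, hs⟩ :=
    ((hcont.eventually (hO.mem_nhds hv)).and self_mem_nhdsWithin).exists
  have hs : 0 < s := hs
  have h1 := hg _ hsO
  have h2 := (le_abs_self _).trans (hf _ hsO _ hv)
  simp only [add_sub_cancel_left, norm_smul, Real.norm_of_nonneg hs.le, inner_smul_right,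
    real_inner_self_eq_norm_sq] at h1 h2
  have hgpos : 0 < ‖g‖ := norm_pos_iff.2 hg0
  have h3 : (s * ‖g‖) * ‖g‖ ≤ (s * ‖g‖) * L := by nlinarith
  exact le_of_mul_le_mul_left h3 (by positivity)

/-- Converts the first order optimality condition, an inequality for gradients, into a comparison of
divergences before and after a step. -/
theorem bregman_three_point {m : ℕ} (ψ : Vec m → ℝ) (z y v : Vec m) :
    bregman ψ z y = bregman ψ z v - bregman ψ y v
      - inner ℝ (gradient ψ y - gradient ψ v) (z - y) := by
  simp only [bregman, inner_sub_left, inner_sub_right]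
  ring

/-- First order optimality condition for a mirror step. -/
theorem MirrorStep.inner_nonneg {m : ℕ} {X : Set (Vec m)} (hX : Convex ℝ X) {ψ : Vec m → ℝ}
    {a : ℝ} (ha : 0 < a) {g v y : Vec m} (h : MirrorStep X ψ a g v y)
    (hd : DifferentiableAt ℝ ψ y) {z : Vec m} (hz : z ∈ X) :
    0 ≤ a * inner ℝ g (z - y) + inner ℝ (gradient ψ y - gradient ψ v) (z - y) := by
  obtain ⟨hy, hmin⟩ := h
  have h1 : HasFDerivAt ψ (innerSL ℝ (gradient ψ y)) y := hd.hasGradientAt.hasFDerivAt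
  have h2 : ∀ b : Vec m, HasFDerivAt (fun x => inner ℝ b (x - v)) (innerSL ℝ b) y := by
    intro b
    have : HasFDerivAt (fun x => innerSL ℝ b (x - v))
        ((innerSL ℝ b).comp (ContinuousLinearMap.id ℝ _)) y :=
      (innerSL ℝ b).hasFDerivAt.comp y ((hasFDerivAt_id y).sub_const v)
    simpa using this
  have h3 : HasFDerivAt (fun x => inner ℝ g (x - v) + 1 / a * bregman ψ x v)
      (innerSL ℝ g + (1 / a) • (innerSL ℝ (gradient ψ y) - innerSL ℝ (gradient ψ v))) y :=
    (h2 g).add (((h1.sub_const (ψ v)).sub (h2 (gradient ψ v))).const_mul (1 / a))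
  have h4 := hmin.localize.hasFDerivWithinAt_nonneg h3.hasFDerivWithinAt
    (sub_mem_posTangentConeAt_of_segment_subset (hX.segment_subset hy hz))
  have h5 : 0 ≤ inner ℝ g (z - y) + (1 / a) * inner ℝ (gradient ψ y - gradient ψ v) (z - y) := by
    simpa [inner_sub_left] using h4
  have h6 := mul_nonneg ha.le h5
  rwa [mul_add, ← mul_assoc a (1 / a), mul_one_div_cancel ha.ne', one_mul] at h6

/-- A mirror step moves by at most a multiple of the step size. -/
theorem MirrorStep.norm_sub_le {m : ℕ} {X : Set (Vec m)} (hX : Convex ℝ X) {ψ : Vec m → ℝ}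
    {a : ℝ} (ha : 0 < a) {g v y : Vec m} (h : MirrorStep X ψ a g v y)
    (hd : DifferentiableAt ℝ ψ y) (hv : v ∈ X) {c L : ℝ} (hc : 0 < c)
    (hψ : ∀ x ∈ X, ∀ y ∈ X, c * ‖x - y‖ ^ 2 ≤ bregman ψ x y) (hL : 0 ≤ L) (hg : ‖g‖ ≤ L) :
    ‖y - v‖ ≤ L / c * a := by
  have h1 := h.inner_nonneg hX ha hd hv
  have h2 := hψ y h.1 v hv
  have h3 := hψ v hv y h.1
  -- Optimality tested at `z = v` bounds this symmetrized divergence by `a * L * ‖y - v‖`, while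
  -- strong convexity makes it at least `2 * c * ‖y - v‖ ^ 2`.
  have h4 : bregman ψ y v + bregman ψ v y = - inner ℝ (gradient ψ y - gradient ψ v) (v - y) := by
    simp only [bregman, inner_sub_left, inner_sub_right]
    ring
  have h5 : inner ℝ g (v - y) ≤ L * ‖y - v‖ := by
    rw [norm_sub_rev]
    exact (real_inner_le_norm _ _).trans (mul_le_mul_of_nonneg_right hg (norm_nonneg _))
  rw [norm_sub_rev v y] at h3
  rw [div_mul_eq_mul_div, le_div_iff₀ hc]
  rcases (norm_nonneg (y - v)).eq_or_lt with h0 | h0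
  · rw [← h0, zero_mul]
    positivity
  · have h6 : c * ‖y - v‖ ^ 2 ≤ a * (L * ‖y - v‖) := by
      nlinarith [mul_le_mul_of_nonneg_left h5 ha.le]
    have h7 : ‖y - v‖ * (‖y - v‖ * c) ≤ ‖y - v‖ * (L * a) := by nlinarith
    exact le_of_mul_le_mul_left h7 h0

/-- Progress of a mirror step along a subgradient. -/
theorem MirrorStep.bregman_le {m : ℕ} {X O : Set (Vec m)} (hX : Convex ℝ X) (hXO : X ⊆ O)
    {ψ : Vec m → ℝ} {a : ℝ} (ha : 0 < a) {g v y : Vec m} (h : MirrorStep X ψ a g v y)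
    (hd : DifferentiableAt ℝ ψ y) (hv : v ∈ X) {c L : ℝ} (hc : 0 < c)
    (hψ : ∀ x ∈ X, ∀ y ∈ X, c * ‖x - y‖ ^ 2 ≤ bregman ψ x y) (hL : 0 ≤ L) (hg : ‖g‖ ≤ L)
    {f : Vec m → ℝ} (hgf : g ∈ subdiff O f v) {z : Vec m} (hz : z ∈ X) :
    bregman ψ z y ≤ bregman ψ z v + a * (f z - f v) + L * (L / c) * a ^ 2 := by
  have h1 := h.inner_nonneg hX ha hd hz
  have h2 := h.norm_sub_le hX ha hd hv hc hψ hL hg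
  have h3 := hgf z (hXO hz)
  have h4 : 0 ≤ bregman ψ y v := le_trans (by positivity) (hψ y h.1 v hv)
  have h5 : inner ℝ g (v - y) ≤ L * (L / c * a) := by
    rw [norm_sub_rev] at h2
    exact (real_inner_le_norm _ _).trans (mul_le_mul hg h2 (norm_nonneg _) hL)
  -- The first part is controlled by the subgradient inequality at `v`, the second by the length of
  -- the step.
  have h6 : inner ℝ g (z - y) = inner ℝ g (z - v) + inner ℝ g (v - y) := by
    rw [← inner_add_right, sub_add_sub_cancel]
  have h7 : a * inner ℝ g (z - y) ≤ a * (f z - f v + L * (L / c * a)) :=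
    mul_le_mul_of_nonneg_left (by linarith) ha.le
  rw [bregman_three_point ψ z y v]
  nlinarith

/-- Convergence implies convergence of the Bregman divergence in its second argument. -/
theorem IsRegularizer.tendsto_bregman {m : ℕ} {p : ENNReal} {σ : ℝ} {X : Set (Vec m)}
    {ψ : Vec m → ℝ} (hψ : IsRegularizer p σ X ψ) {z : Vec m} (hz : z ∈ X) {s : ℕ → Vec m}
    (hs : ∀ k, s k ∈ X) (h : Tendsto s atTop (𝓝 z)) :
    Tendsto (fun k => bregman ψ z (s k)) atTop (𝓝 0) := by
  have h1 : Tendsto (fun k => ψ (s k)) atTop (𝓝 (ψ z)) :=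
    (hψ.differentiable z hz).continuousAt.tendsto.comp h
  have h2 : Tendsto (fun k => gradient ψ (s k)) atTop (𝓝 (gradient ψ z)) :=
    (hψ.gradient_continuous z hz).tendsto.comp
      (tendsto_nhdsWithin_iff.2 ⟨h, Eventually.of_forall hs⟩)
  have h3 := (tendsto_const_nhds (x := ψ z)).sub h1 |>.sub
    (h2.inner ((tendsto_const_nhds (x := z)).sub h))
  simpa [bregman] using h3

/-- The average of the estimates of all agents. -/
noncomputable def agentMean {m n : ℕ} (x : Fin n → Vec m) : Vec m := ∑ i, (1 / (n : ℝ)) • x i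

theorem sum_one_div_card {n : ℕ} (hn : 0 < n) : ∑ _i : Fin n, (1 / (n : ℝ)) = 1 := by
  have : (n : ℝ) ≠ 0 := by positivity
  simp [this]

theorem agentMean_mem {m n : ℕ} (hn : 0 < n) {X : Set (Vec m)} (hX : Convex ℝ X)
    {x : Fin n → Vec m} (hx : ∀ i, x i ∈ X) : agentMean x ∈ X :=
  hX.sum_mem (fun _ _ => by positivity) (sum_one_div_card hn) fun i _ => hx i

/-- The case `δ = 0` of the contraction estimate. It covers averages within a subnetwork as well as
cross averages. -/
theorem norm_sum_smul_sub_agentMean_le {m n : ℕ} (hn : 0 < n) {w : Fin n → ℝ} (hw : ∀ k, 0 ≤ w k)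
    (hw1 : ∑ k, w k = 1) (x : Fin n → Vec m) :
    ‖∑ k, w k • x k - agentMean x‖ ≤ Metric.diam (Set.range x) := by
  have := norm_sum_smul_sub_sum_smul_le hw (fun _ => by positivity) hw1 (sum_one_div_card hn) hw x
  rwa [sub_zero, one_mul] at this

theorem norm_sub_agentMean_le {m n : ℕ} (hn : 0 < n) (x : Fin n → Vec m) (i : Fin n) :
    ‖x i - agentMean x‖ ≤ Metric.diam (Set.range x) := by
  have := norm_sum_smul_sub_agentMean_le hn (w := fun k => if k = i then 1 else 0)
    (fun k => by split_ifs <;> norm_num) (by simp) x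
  simpa using this

theorem WeightsAdapted.nonneg {V : Type*} {η : ℝ} {G : ℕ → Digraph V} {W : ℕ → Matrix V V ℝ}
    (h : WeightsAdapted η G W) (hη : 0 < η) (t : ℕ) (i j : V) : 0 ≤ W t i j := by
  by_cases hadj : (G t).Adj j i
  · exact hη.le.trans ((h t i j).1 hadj)
  · exact ((h t i j).2 hadj).ge

/-- The part of a run that concerns one subnetwork: the estimates `u t i` of the opponent's action,
with values in `X'`, are arbitrary. -/
structure SubnetworkRun {m m' n : ℕ} (p p' : ENNReal) (L L' σ η : ℝ) (X O : Set (Vec m))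
    (X' : Set (Vec m')) (f : Fin n → Vec m → Vec m' → ℝ) (ψ : Vec m → ℝ)
    (G : ℕ → Digraph (Fin n)) (W : ℕ → Matrix (Fin n) (Fin n) ℝ) (α : ℕ → ℝ)
    (u : ℕ → Fin n → Vec m') (x g : ℕ → Fin n → Vec m) : Prop where
  card_pos : 0 < n
  one_le_p : 1 ≤ p
  one_le_p' : 1 ≤ p'
  convex : Convex ℝ X
  isOpen : IsOpen O
  subset : X ⊆ O
  lipschitz : ∀ i, ∀ b ∈ X', LipschitzOnLp p L O fun a => f i a b
  lipschitz' : ∀ i, ∀ a ∈ X, LipschitzOnLp p' L' X' (f i a)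
  regularizer : IsRegularizer p σ X ψ
  convex_right : ∀ z ∈ X, ConvexOn ℝ X fun y => bregman ψ z y
  connected : UniformlyJointlyStronglyConnected G
  self : ∀ k i, (G k).Adj i i
  eta_pos : 0 < η
  weights : WeightsAdapted η G W
  row_sum : ∀ k i, ∑ j, W k i j = 1
  col_sum : ∀ k j, ∑ i, W k i j = 1
  step_pos : ∀ t, 0 < α t
  mem : ∀ t i, x t i ∈ X
  opponent_mem : ∀ t i, u t i ∈ X'
  subgradient : ∀ t i, g t i ∈ subdiff O (fun a => f i a (u t i)) (ownAverage (W t) (x t) i)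
  update : ∀ t i, MirrorStep X ψ (α t) (g t i) (ownAverage (W t) (x t) i) (x (t + 1) i)

namespace SubnetworkRun

variable {m m' n : ℕ} {p p' : ENNReal} {L L' σ η : ℝ} {X O : Set (Vec m)}
    {X' : Set (Vec m')} {f : Fin n → Vec m → Vec m' → ℝ} {ψ : Vec m → ℝ}
    {G : ℕ → Digraph (Fin n)} {W : ℕ → Matrix (Fin n) (Fin n) ℝ} {α : ℕ → ℝ}
    {u : ℕ → Fin n → Vec m'} {x g : ℕ → Fin n → Vec m}

theorem weight_nonneg (h : SubnetworkRun p p' L L' σ η X O X' f ψ G W α u x g) (t : ℕ)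
    (i j : Fin n) : 0 ≤ W t i j :=
  h.weights.nonneg h.eta_pos t i j

theorem ownAverage_mem (h : SubnetworkRun p p' L L' σ η X O X' f ψ G W α u x g) (t : ℕ)
    (i : Fin n) : ownAverage (W t) (x t) i ∈ X :=
  h.convex.sum_mem (fun _ _ => h.weight_nonneg _ _ _) (h.row_sum t i) fun j _ => h.mem t j

/-- The disagreement within the subnetwork is summable against the step sizes. -/
theorem summable_step_mul_diam (h : SubnetworkRun p p' L L' σ η X O X' f ψ G W α u x g)
    (hα_mono : Antitone α) (hα_sq : Summable fun t => α t ^ 2) :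
    Summable fun t => α t * Metric.diam (Set.range (x t)) := by
  obtain ⟨Λ, hΛ, hlip⟩ := exists_lipschitz_of_lipschitzOnLp m h.one_le_p L
  obtain ⟨c, hc, hψ⟩ := h.regularizer.exists_le_bregman h.one_le_p
  refine summable_mul_diam_range h.connected h.eta_pos h.weight_nonneg
    (fun t i => (h.weights t i i).1 (h.self t i)) (fun t i j => (h.weights t i j).1) h.row_sum
    (fun t => (h.step_pos t).le) hα_mono hα_sq (div_nonneg hΛ hc.le) fun t i => ?_
  exact (h.update t i).norm_sub_le h.convex (h.step_pos t)
    (h.regularizer.differentiable _ (h.mem _ _)) (h.ownAverage_mem t i) hc hψ hΛ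
    (norm_le_of_mem_subdiff h.isOpen (hlip O _ (h.lipschitz i _ (h.opponent_mem t i)))
      (h.subset (h.ownAverage_mem t i)) (h.subgradient t i) hΛ)

/-- Double stochasticity and convexity of the Bregman divergence in its second argument: averaging
does not increase the total divergence. -/
theorem sum_bregman_ownAverage_le (h : SubnetworkRun p p' L L' σ η X O X' f ψ G W α u x g)
    {z : Vec m} (hz : z ∈ X) (t : ℕ) :
    ∑ i, bregman ψ z (ownAverage (W t) (x t) i) ≤ ∑ i, bregman ψ z (x t i) := by
  calc _ ≤ ∑ i, ∑ j, W t i j * bregman ψ z (x t j) := by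
        refine Finset.sum_le_sum fun i _ => ?_
        exact (h.convex_right z hz).map_sum_le (fun _ _ => h.weight_nonneg _ _ _) (h.row_sum t i)
          fun j _ => h.mem t j
    _ = _ := by
        rw [Finset.sum_comm]
        simp only [← Finset.sum_mul, h.col_sum, one_mul]

/-- Progress of the subnetwork in one round, with the opponent's actual action replaced by a
point `b` close to its estimates. -/
theorem exists_sum_bregman_le (h : SubnetworkRun p p' L L' σ η X O X' f ψ G W α u x g) :
    ∃ C : ℝ, 0 ≤ C ∧ ∀ z ∈ X, ∀ b ∈ X', ∀ t d', (∀ i, ‖u t i - b‖ ≤ d') →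
      1 / (n : ℝ) * ∑ i, bregman ψ z (x (t + 1) i) ≤ 1 / (n : ℝ) * ∑ i, bregman ψ z (x t i)
        + α t * (1 / (n : ℝ) * ∑ i, f i z b - 1 / (n : ℝ) * ∑ i, f i (agentMean (x t)) b)
        + C * (α t ^ 2 + α t * Metric.diam (Set.range (x t)) + α t * d') := by
  obtain ⟨Λ, hΛ, hlip⟩ := exists_lipschitz_of_lipschitzOnLp m h.one_le_p L
  obtain ⟨Λ', hΛ', hlip'⟩ := exists_lipschitz_of_lipschitzOnLp m' h.one_le_p' L'
  obtain ⟨c, hc, hψ⟩ := h.regularizer.exists_le_bregman h.one_le_p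
  have hn : (0 : ℝ) < n := by exact_mod_cast h.card_pos
  -- The three terms pay for the mirror step, for moving from `v i` to the mean, and for replacing
  -- `u t i` by `b` at both `z` and the mean.
  refine ⟨Λ * (Λ / c) + Λ + 2 * Λ', by positivity, fun z hz b hb t d' hd' => ?_⟩
  set C := Λ * (Λ / c) + Λ + 2 * Λ' with hC
  set D := Metric.diam (Set.range (x t))
  set y := agentMean (x t)
  set v := ownAverage (W t) (x t) with hv
  have hα := h.step_pos t
  have hD : 0 ≤ D := Metric.diam_nonneg
  have hd0 : 0 ≤ d' := (norm_nonneg _).trans (hd' ⟨0, h.card_pos⟩)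
  have hy : y ∈ X := agentMean_mem h.card_pos h.convex (h.mem t)
  have hagent : ∀ i, bregman ψ z (x (t + 1) i) ≤ bregman ψ z (v i) + α t * (f i z b - f i y b)
      + C * (α t ^ 2 + α t * D + α t * d') := by
    intro i
    have hvi : v i ∈ X := h.ownAverage_mem t i
    have hu := h.opponent_mem t i
    have h1 := (h.update t i).bregman_le h.convex h.subset hα
      (h.regularizer.differentiable _ (h.mem _ _)) hvi hc hψ hΛ
      (norm_le_of_mem_subdiff h.isOpen (hlip O _ (h.lipschitz i _ hu))
        (h.subset hvi) (h.subgradient t i) hΛ) (h.subgradient t i) hz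
    have h2 : f i z (u t i) - f i z b ≤ Λ' * d' :=
      ((le_abs_self _).trans (hlip' X' _ (h.lipschitz' i z hz) _ hu _ hb)).trans
        (mul_le_mul_of_nonneg_left (hd' i) hΛ')
    have h3 : f i y b - f i y (u t i) ≤ Λ' * d' := by
      have := hlip' X' _ (h.lipschitz' i y hy) _ hu _ hb
      have h4 := mul_le_mul_of_nonneg_left (hd' i) hΛ'
      linarith [neg_abs_le (f i y (u t i) - f i y b)]
    have h4 : f i y (u t i) - f i (v i) (u t i) ≤ Λ * D := by
      have h5 := hlip O _ (h.lipschitz i _ hu) _ (h.subset hvi) _ (h.subset hy)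
      have h6 : ‖v i - y‖ ≤ D := norm_sum_smul_sub_agentMean_le h.card_pos
        (fun k => h.weight_nonneg t i k) (h.row_sum t i) (x t)
      have h7 := mul_le_mul_of_nonneg_left h6 hΛ
      linarith [neg_abs_le (f i (v i) (u t i) - f i y (u t i))]
    have h5 : α t * (f i z (u t i) - f i (v i) (u t i))
        ≤ α t * (f i z b - f i y b + (2 * Λ' * d' + Λ * D)) :=
      mul_le_mul_of_nonneg_left (by linarith) hα.le
    have h6 : Λ * (Λ / c) * α t ^ 2 + Λ * (α t * D) + 2 * Λ' * (α t * d')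
        ≤ C * (α t ^ 2 + α t * D + α t * d') := by
      have e1 : 0 ≤ Λ * (Λ / c) := by positivity
      have a1 : 0 ≤ α t ^ 2 := by positivity
      have a2 : 0 ≤ α t * D := by positivity
      have a3 : 0 ≤ α t * d' := by positivity
      have b1 : Λ * (Λ / c) * α t ^ 2 ≤ C * α t ^ 2 :=
        mul_le_mul_of_nonneg_right (by linarith) a1
      have b2 : Λ * (α t * D) ≤ C * (α t * D) := mul_le_mul_of_nonneg_right (by linarith) a2
      have b3 : 2 * Λ' * (α t * d') ≤ C * (α t * d') :=
        mul_le_mul_of_nonneg_right (by linarith) a3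
      linarith
    linarith
  have hsum : ∑ i, bregman ψ z (x (t + 1) i) ≤ ∑ i, bregman ψ z (x t i)
      + α t * (∑ i, f i z b - ∑ i, f i y b) + n * (C * (α t ^ 2 + α t * D + α t * d')) := by
    refine (Finset.sum_le_sum fun i _ => hagent i).trans ?_
    rw [Finset.sum_add_distrib, Finset.sum_add_distrib, ← Finset.mul_sum, Finset.sum_sub_distrib]
    have := h.sum_bregman_ownAverage_le hz t
    simp only [Finset.sum_const, Finset.card_univ, Fintype.card_fin, nsmul_eq_mul]
    linarith
  have := mul_le_mul_of_nonneg_left hsum (one_div_pos.2 hn).le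
  refine this.trans_eq ?_
  field_simp

end SubnetworkRun

end MirrorDescent

/-! ### Summability and convergence along subsequences -/

section Sequences

/-- If `∑ α t * r t` converges while `∑ α t` diverges, then `r` tends to zero along a
subsequence. -/
theorem exists_subseq_tendsto_zero_of_summable_mul {α r : ℕ → ℝ} (hα : ∀ t, 0 < α t)
    (hr : ∀ t, 0 ≤ r t)
    (hα_sum : Tendsto (fun T => ∑ t ∈ Finset.range T, α t) atTop atTop)
    (h : Summable fun t => α t * r t) :
    ∃ φ : ℕ → ℕ, StrictMono φ ∧ Tendsto (fun k => r (φ k)) atTop (𝓝 0) := by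
  -- If `r` were eventually at least `1 / (k + 1)`, summability of `α t * r t` would force that of
  -- `α`.
  have hfreq : ∀ k : ℕ, ∃ᶠ t in atTop, r t < 1 / ((k : ℝ) + 1) := by
    intro k hk
    have hε : (0 : ℝ) < 1 / ((k : ℝ) + 1) := by positivity
    have hsum : Summable fun t => α t * (1 / ((k : ℝ) + 1)) := by
      refine h.of_norm_bounded_eventually_nat ?_
      filter_upwards [hk] with t ht
      rw [Real.norm_of_nonneg (mul_nonneg (hα t).le hε.le)]
      exact mul_le_mul_of_nonneg_left (not_lt.1 ht) (hα t).le
    rw [summable_mul_right_iff hε.ne'] at hsum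
    exact not_tendsto_atTop_of_tendsto_nhds hsum.hasSum.tendsto_sum_nat hα_sum
  obtain ⟨φ, hφ, hlt⟩ := extraction_forall_of_frequently hfreq
  exact ⟨φ, hφ, squeeze_zero (fun k => hr _) (fun k => (hlt k).le)
    tendsto_one_div_add_atTop_nhds_zero_nat⟩

/-- No sign is imposed on `b`: it is applied to summable errors and also to errors minus the
weighted gap. -/
theorem le_add_sum_of_succ_le {V b : ℕ → ℝ} (h : ∀ t, V (t + 1) ≤ V t + b t) (s k : ℕ) :
    V (s + k) ≤ V s + ∑ r ∈ Finset.range k, b (r + s) := by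
  induction k with
  | zero => simp
  | succ k ih =>
    have := h (s + k)
    rw [Finset.sum_range_succ, add_comm k s, ← add_assoc]
    linarith

/-- A nonnegative sequence that is nonincreasing up to summable errors and tends to zero along a
subsequence tends to zero. -/
theorem tendsto_zero_of_subseq {V b : ℕ → ℝ} (hV : ∀ t, 0 ≤ V t) (hb : ∀ t, 0 ≤ b t)
    (hb_sum : Summable b) (h : ∀ t, V (t + 1) ≤ V t + b t) {φ : ℕ → ℕ} (hφ : StrictMono φ)
    (hVφ : Tendsto (fun k => V (φ k)) atTop (𝓝 0)) : Tendsto V atTop (𝓝 0) := by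
  have htail : Tendsto (fun k => V (φ k) + ∑' r, b (r + φ k)) atTop (𝓝 0) := by
    simpa using hVφ.add ((tendsto_sum_nat_add b).comp hφ.tendsto_atTop)
  rw [Metric.tendsto_atTop]
  intro ε hε
  obtain ⟨k, hk⟩ := (htail.eventually (gt_mem_nhds hε)).exists
  refine ⟨φ k, fun t ht => ?_⟩
  obtain ⟨r, rfl⟩ := Nat.exists_eq_add_of_le ht
  rw [Real.dist_eq, sub_zero, abs_of_nonneg (hV _)]
  have h1 := le_add_sum_of_succ_le h (φ k) r
  have h2 := ((summable_nat_add_iff (φ k)).2 hb_sum).sum_le_tsum (Finset.range r)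
    fun s _ => hb (s + φ k)
  linarith

end Sequences

/-! ### Saddle points from bounded regret -/

section SaddlePoints

/-- If the weighted regret of a sequence of pairs of actions is bounded and the weights are not
summable, then a limit point of the weighted averages is a saddle point. -/
theorem exists_saddlePoint_of_regret_bounded {E F : Type*} [NormedAddCommGroup E]
    [NormedSpace ℝ E] [NormedAddCommGroup F] [NormedSpace ℝ F] {X : Set E} {Y : Set F}
    (hXc : IsCompact X) (hYc : IsCompact Y) (hX : Convex ℝ X) (hY : Convex ℝ Y) {U : E → F → ℝ}
    (hconv : ∀ b ∈ Y, ConvexOn ℝ X fun a => U a b) (hconc : ∀ a ∈ X, ConcaveOn ℝ Y (U a))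
    (hcontX : ∀ b ∈ Y, ContinuousOn (fun a => U a b) X) (hcontY : ∀ a ∈ X, ContinuousOn (U a) Y)
    {α : ℕ → ℝ} (hα : ∀ t, 0 < α t)
    (hα_sum : Tendsto (fun T => ∑ t ∈ Finset.range T, α t) atTop atTop)
    {x : ℕ → E} {y : ℕ → F} (hx : ∀ t, x t ∈ X) (hy : ∀ t, y t ∈ Y)
    (hreg : ∀ a ∈ X, ∀ b ∈ Y, ∃ C : ℝ, ∀ T,
      ∑ t ∈ Finset.range T, α t * (U (x t) b - U a (y t)) ≤ C) :
    ∃ a ∈ X, ∃ b ∈ Y, IsMinOn (fun a' => U a' b) X a ∧ IsMaxOn (U a) Y b := by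
  -- Summing to `T + 1` makes every total weight positive, so all centers of mass are genuine
  -- averages.
  set A : ℕ → ℝ := fun T => ∑ t ∈ Finset.range (T + 1), α t with hA
  have hA0 : ∀ T, 0 < A T := fun T => Finset.sum_pos (fun t _ => hα t) ⟨0, by simp⟩
  have hA_top : Tendsto A atTop atTop := hα_sum.comp (tendsto_add_atTop_nat 1)
  set cx : ℕ → E := fun T => (Finset.range (T + 1)).centerMass α x with hcx
  set cy : ℕ → F := fun T => (Finset.range (T + 1)).centerMass α y with hcy
  have hcxX : ∀ T, cx T ∈ X := fun T =>
    hX.centerMass_mem (fun t _ => (hα t).le) (hA0 T) fun t _ => hx t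
  have hcyY : ∀ T, cy T ∈ Y := fun T =>
    hY.centerMass_mem (fun t _ => (hα t).le) (hA0 T) fun t _ => hy t
  obtain ⟨⟨a, b⟩, ⟨ha, hb⟩, φ, hφ, hlim⟩ :=
    (hXc.prod hYc).tendsto_subseq (x := fun T => (cx T, cy T)) fun T => ⟨hcxX T, hcyY T⟩
  have hlim1 : Tendsto (fun k => cx (φ k)) atTop (𝓝 a) := (continuous_fst.tendsto _).comp hlim
  have hlim2 : Tendsto (fun k => cy (φ k)) atTop (𝓝 b) := (continuous_snd.tendsto _).comp hlim
  -- By Jensen in each variable, the gap of the averages is at most regret over total weight, which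
  -- tends to zero. Setting `b' = b` or `a' = a` then yields the two halves of the saddle property.
  have key : ∀ a' ∈ X, ∀ b' ∈ Y, U a b' ≤ U a' b := by
    intro a' ha' b' hb'
    obtain ⟨C, hC⟩ := hreg a' ha' b' hb'
    have h1 : Tendsto (fun k => U (cx (φ k)) b') atTop (𝓝 (U a b')) :=
      (hcontX b' hb' a ha).tendsto.comp
        (tendsto_nhdsWithin_iff.2 ⟨hlim1, Eventually.of_forall fun k => hcxX _⟩)
    have h2 : Tendsto (fun k => U a' (cy (φ k))) atTop (𝓝 (U a' b)) :=
      (hcontY a' ha' b hb).tendsto.comp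
        (tendsto_nhdsWithin_iff.2 ⟨hlim2, Eventually.of_forall fun k => hcyY _⟩)
    have h3 : Tendsto (fun k => C / A (φ k)) atTop (𝓝 0) :=
      (hA_top.comp hφ.tendsto_atTop).const_div_atTop C
    have h4 : ∀ T, U (cx T) b' - U a' (cy T) ≤ C / A T := by
      intro T
      have h5 := (hconv b' hb').map_centerMass_le (t := Finset.range (T + 1)) (w := α) (p := x)
        (fun t _ => (hα t).le) (hA0 T) fun t _ => hx t
      have h6 := (hconc a' ha').le_map_centerMass (t := Finset.range (T + 1)) (w := α) (p := y)
        (fun t _ => (hα t).le) (hA0 T) fun t _ => hy t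
      have h7 := hC (T + 1)
      simp only [Finset.centerMass, Function.comp, smul_eq_mul] at h5 h6
      rw [inv_mul_eq_div, le_div_iff₀ (hA0 T)] at h5
      rw [inv_mul_eq_div, div_le_iff₀ (hA0 T)] at h6
      simp only [mul_sub, Finset.sum_sub_distrib] at h7
      rw [le_div_iff₀ (hA0 T), sub_mul]
      simp only [hcx, hcy, Finset.centerMass, hA] at h5 h6 ⊢
      linarith
    have h5 := le_of_tendsto_of_tendsto' (h1.sub h2) h3 fun k => h4 (φ k)
    linarith
  exact ⟨a, ha, b, hb, fun a' ha' => key a' ha' b hb, fun b' hb' => key a ha b' hb'⟩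

end SaddlePoints

/-! ### Continuity of `U` and rigidity of strict equilibria -/

namespace SubnetworkGame

variable {m₁ m₂ n₁ n₂ : ℕ} {G : SubnetworkGame m₁ m₂ n₁ n₂} {p₁ p₂ : ENNReal}
  {L₁₁ L₁₂ L₂₁ L₂₂ : ℝ}

theorem GameAssumption.continuousOn_U_left (h : G.GameAssumption p₁ p₂ L₁₁ L₁₂ L₂₁ L₂₂)
    (hp : 1 ≤ p₁) {b : Vec m₂} (hb : b ∈ G.X₂) : ContinuousOn (fun a => G.U a b) G.X₁ :=
  continuousOn_const.mul (continuousOn_finsetSum _ fun i _ =>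
    ((h.f₁_lip₁ i b hb).continuousOn hp).mono h.subset₁)

theorem GameAssumption.continuousOn_U_right (h : G.GameAssumption p₁ p₂ L₁₁ L₁₂ L₂₁ L₂₂)
    (hp : 1 ≤ p₂) {a : Vec m₁} (ha : a ∈ G.X₁) : ContinuousOn (G.U a) G.X₂ :=
  continuousOn_const.mul (continuousOn_finsetSum _ fun i _ =>
    (h.f₁_lip₂ i a ha).continuousOn hp)

/-- A pair of actions with no duality gap against a Nash equilibrium of a strictly convex-concave
game is that equilibrium. -/
theorem StrictlyConvexConcave.eq_of_le (h : G.StrictlyConvexConcave) {z₁ a : Vec m₁}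
    {z₂ b : Vec m₂} (hz : G.IsNash z₁ z₂) (ha : a ∈ G.X₁) (hb : b ∈ G.X₂)
    (hle : G.U a z₂ ≤ G.U z₁ b) : a = z₁ ∧ b = z₂ := by
  obtain ⟨hz₁, hz₂, hmin, hmax⟩ := hz
  have h1 : G.U z₁ z₂ ≤ G.U a z₂ := hmin ha
  have h2 : G.U z₁ b ≤ G.U z₁ z₂ := hmax hb
  -- The chain `U z₁ b ≤ U z₁ z₂ ≤ U a z₂ ≤ U z₁ b` collapses to equalities, so `a` and `b` are also
  -- optimal against `z₂` and `z₁`.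
  constructor
  · refine (h.1 z₂ hz₂).eq_of_isMinOn (fun c hc => ?_) hmin ha hz₁
    have h3 : G.U z₁ z₂ ≤ G.U c z₂ := hmin hc
    change G.U a z₂ ≤ G.U c z₂
    linarith
  · refine (h.2 z₁ hz₁).eq_of_isMaxOn (fun c hc => ?_) hmax hb hz₂
    have h3 : G.U z₁ c ≤ G.U z₁ z₂ := hmax hc
    change G.U z₁ c ≤ G.U z₁ b
    linarith

end SubnetworkGame

/-! ### Both subnetworks together: descent of the total divergence -/

section Run

variable {m₁ m₂ n₁ n₂ : ℕ} {p₁ p₂ : ENNReal} {G : SubnetworkGame m₁ m₂ n₁ n₂}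
  {L₁₁ L₁₂ L₂₁ L₂₂ : ℝ} {N : CommNetwork n₁ n₂} {η : ℝ} {ψ₁ : Vec m₁ → ℝ} {ψ₂ : Vec m₂ → ℝ}
  {σ₁ σ₂ : ℝ} {α : ℕ → ℝ} {x₁ g₁ : ℕ → Fin n₁ → Vec m₁} {x₂ g₂ : ℕ → Fin n₂ → Vec m₂}

theorem IsRun.mem₁ (h : IsRun G N ψ₁ ψ₂ α x₁ g₁ x₂ g₂) : ∀ t i, x₁ t i ∈ G.X₁
  | 0, i => h.init₁ i
  | t + 1, i => (h.update₁ t i).1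

theorem IsRun.mem₂ (h : IsRun G N ψ₁ ψ₂ α x₁ g₁ x₂ g₂) : ∀ t i, x₂ t i ∈ G.X₂
  | 0, i => h.init₂ i
  | t + 1, i => (h.update₂ t i).1

theorem IsRun.subnetworkRun₁ (h : IsRun G N ψ₁ ψ₂ α x₁ g₁ x₂ g₂) (hn₁ : 0 < n₁) (hp₁ : 1 ≤ p₁)
    (hp₂ : 1 ≤ p₂) (hgame : G.GameAssumption p₁ p₂ L₁₁ L₁₂ L₂₁ L₂₂) (hnet : N.NetworkAssumption η)
    (hψ₁ : IsRegularizer p₁ σ₁ G.X₁ ψ₁) (hD₁ : BregmanAssumption G.X₁ ψ₁)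
    (hα_pos : ∀ t, 0 < α t) :
    SubnetworkRun p₁ p₂ L₁₁ L₁₂ σ₁ η G.X₁ G.O₁ G.X₂ G.f₁ ψ₁ N.G₁ N.W₁ α
      (fun t => crossAverage₂ (N.W₁₂ t) (x₂ t)) x₁ g₁ where
  card_pos := hn₁
  one_le_p := hp₁
  one_le_p' := hp₂
  convex := hgame.convex₁
  isOpen := hgame.open₁
  subset := hgame.subset₁
  lipschitz := hgame.f₁_lip₁
  lipschitz' := hgame.f₁_lip₂
  regularizer := hψ₁
  convex_right := hD₁.convex_right
  connected := hnet.connected₁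
  self := hnet.self₁
  eta_pos := hnet.eta_pos
  weights := hnet.weights₁
  row_sum := hnet.row_sum₁
  col_sum := hnet.col_sum₁
  step_pos := hα_pos
  mem := h.mem₁
  opponent_mem t i := hgame.convex₂.sum_mem
    (fun _ _ => hnet.weights₁₂.nonneg hnet.eta_pos _ _ _) (hnet.cross_sum₁ t i)
    fun j _ => h.mem₂ t j
  subgradient := h.subgradient₁
  update := h.update₁

/-- The players exchange roles: the costs take their arguments in the opposite order, and `L₂₁`
belongs to the own variable. -/
theorem IsRun.subnetworkRun₂ (h : IsRun G N ψ₁ ψ₂ α x₁ g₁ x₂ g₂) (hn₂ : 0 < n₂) (hp₁ : 1 ≤ p₁)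
    (hp₂ : 1 ≤ p₂) (hgame : G.GameAssumption p₁ p₂ L₁₁ L₁₂ L₂₁ L₂₂) (hnet : N.NetworkAssumption η)
    (hψ₂ : IsRegularizer p₂ σ₂ G.X₂ ψ₂) (hD₂ : BregmanAssumption G.X₂ ψ₂)
    (hα_pos : ∀ t, 0 < α t) :
    SubnetworkRun p₂ p₁ L₂₁ L₂₂ σ₂ η G.X₂ G.O₂ G.X₁ (fun i b a => G.f₂ i a b) ψ₂ N.G₂ N.W₂ α
      (fun t => crossAverage₁ (N.W₁₂ t) (x₁ t)) x₂ g₂ where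
  card_pos := hn₂
  one_le_p := hp₂
  one_le_p' := hp₁
  convex := hgame.convex₂
  isOpen := hgame.open₂
  subset := hgame.subset₂
  lipschitz := hgame.f₂_lip₂
  lipschitz' := hgame.f₂_lip₁
  regularizer := hψ₂
  convex_right := hD₂.convex_right
  connected := hnet.connected₂
  self := hnet.self₂
  eta_pos := hnet.eta_pos
  weights := hnet.weights₂
  row_sum := hnet.row_sum₂
  col_sum := hnet.col_sum₂
  step_pos := hα_pos
  mem := h.mem₂
  opponent_mem t i := hgame.convex₁.sum_mem
    (fun _ _ => hnet.weights₁₂.nonneg hnet.eta_pos _ _ _) (hnet.cross_sum₂ t i)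
    fun j _ => h.mem₁ t j
  subgradient := h.subgradient₂
  update := h.update₂

/-- Total Bregman divergence of the estimates of all agents from a pair of actions. -/
noncomputable def totalDivergence (ψ₁ : Vec m₁ → ℝ) (ψ₂ : Vec m₂ → ℝ) (z₁ : Vec m₁) (z₂ : Vec m₂)
    (x₁ : Fin n₁ → Vec m₁) (x₂ : Fin n₂ → Vec m₂) : ℝ :=
  1 / (n₁ : ℝ) * ∑ i, bregman ψ₁ z₁ (x₁ i) + 1 / (n₂ : ℝ) * ∑ j, bregman ψ₂ z₂ (x₂ j)

/-- In each round the total divergence decreases by the duality gap of the averages of the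
estimates, up to a summable error. -/
theorem IsRun.exists_totalDivergence_le (h : IsRun G N ψ₁ ψ₂ α x₁ g₁ x₂ g₂) (hn₁ : 0 < n₁)
    (hn₂ : 0 < n₂) (hp₁ : 1 ≤ p₁) (hp₂ : 1 ≤ p₂) (hzero : G.ZeroSum)
    (hgame : G.GameAssumption p₁ p₂ L₁₁ L₁₂ L₂₁ L₂₂) (hnet : N.NetworkAssumption η)
    (hψ₁ : IsRegularizer p₁ σ₁ G.X₁ ψ₁) (hψ₂ : IsRegularizer p₂ σ₂ G.X₂ ψ₂)
    (hD₁ : BregmanAssumption G.X₁ ψ₁) (hD₂ : BregmanAssumption G.X₂ ψ₂)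
    (hα_pos : ∀ t, 0 < α t) (hα_mono : Antitone α) (hα_sq : Summable (fun t => α t ^ 2)) :
    ∃ e : ℕ → ℝ, (∀ t, 0 ≤ e t) ∧ Summable e ∧ ∀ z₁ ∈ G.X₁, ∀ z₂ ∈ G.X₂, ∀ t,
      totalDivergence ψ₁ ψ₂ z₁ z₂ (x₁ (t + 1)) (x₂ (t + 1))
        ≤ totalDivergence ψ₁ ψ₂ z₁ z₂ (x₁ t) (x₂ t)
          - α t * (G.U (agentMean (x₁ t)) z₂ - G.U z₁ (agentMean (x₂ t))) + e t := by
  have r₁ := h.subnetworkRun₁ hn₁ hp₁ hp₂ hgame hnet hψ₁ hD₁ hα_pos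
  have r₂ := h.subnetworkRun₂ hn₂ hp₁ hp₂ hgame hnet hψ₂ hD₂ hα_pos
  obtain ⟨C₁, hC₁, H₁⟩ := r₁.exists_sum_bregman_le
  obtain ⟨C₂, hC₂, H₂⟩ := r₂.exists_sum_bregman_le
  have s₁ := r₁.summable_step_mul_diam hα_mono hα_sq
  have s₂ := r₂.summable_step_mul_diam hα_mono hα_sq
  refine ⟨fun t => (C₁ + C₂) * (α t ^ 2 + α t * Metric.diam (Set.range (x₁ t))
    + α t * Metric.diam (Set.range (x₂ t))), fun t => ?_, ((hα_sq.add s₁).add s₂).mul_left _,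
    fun z₁ hz₁ z₂ hz₂ t => ?_⟩
  · have := (hα_pos t).le
    have h1 : 0 ≤ Metric.diam (Set.range (x₁ t)) := Metric.diam_nonneg
    have h2 : 0 ≤ Metric.diam (Set.range (x₂ t)) := Metric.diam_nonneg
    positivity
  · have hm₁ : agentMean (x₁ t) ∈ G.X₁ := agentMean_mem hn₁ hgame.convex₁ (h.mem₁ t)
    have hm₂ : agentMean (x₂ t) ∈ G.X₂ := agentMean_mem hn₂ hgame.convex₂ (h.mem₂ t)
    have k₁ := H₁ z₁ hz₁ _ hm₂ t _ fun i => norm_sum_smul_sub_agentMean_le hn₂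
      (fun j => hnet.weights₁₂.nonneg hnet.eta_pos t (Sum.inl i) (Sum.inr j))
      (hnet.cross_sum₁ t i) (x₂ t)
    have k₂ := H₂ z₂ hz₂ _ hm₁ t _ fun i => norm_sum_smul_sub_agentMean_le hn₁
      (fun j => hnet.weights₁₂.nonneg hnet.eta_pos t (Sum.inr i) (Sum.inl j))
      (hnet.cross_sum₂ t i) (x₁ t)
    -- Zero-sum rewrites the second subnetwork's progress in terms of `U`; the value at the pair of
    -- means then cancels against the first one's.
    have e₁ := hzero _ hm₁ _ hz₂
    have e₂ := hzero _ hm₁ _ hm₂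
    simp only [totalDivergence, SubnetworkGame.U, SubnetworkGame.cost₁,
      SubnetworkGame.cost₂] at e₁ e₂ ⊢
    rw [show 1 / (n₂ : ℝ) * ∑ i, G.f₂ i (agentMean (x₁ t)) z₂
      - 1 / (n₂ : ℝ) * ∑ i, G.f₂ i (agentMean (x₁ t)) (agentMean (x₂ t))
      = 1 / (n₁ : ℝ) * ∑ i, G.f₁ i (agentMean (x₁ t)) (agentMean (x₂ t))
        - 1 / (n₁ : ℝ) * ∑ i, G.f₁ i (agentMean (x₁ t)) z₂ by linarith] at k₂
    linarith

/-- Convergence of the estimates from convergence of the total divergence to zero. -/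
theorem tendsto_of_mean_bregman_le {m n : ℕ} {p : ENNReal} (hp : 1 ≤ p) {σ : ℝ} {X : Set (Vec m)}
    {ψ : Vec m → ℝ} (hψ : IsRegularizer p σ X ψ) {z : Vec m} (hz : z ∈ X)
    {x : ℕ → Fin n → Vec m} (hx : ∀ t i, x t i ∈ X) {V : ℕ → ℝ}
    (hV : ∀ t, 1 / (n : ℝ) * ∑ i, bregman ψ z (x t i) ≤ V t) (hV0 : Tendsto V atTop (𝓝 0))
    (i : Fin n) : Tendsto (fun t => x t i) atTop (𝓝 z) := by
  obtain ⟨c, hc, hle⟩ := hψ.exists_le_bregman hp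
  have hn : (0 : ℝ) < n := by exact_mod_cast i.pos
  have h0 : ∀ t j, 0 ≤ bregman ψ z (x t j) := fun t j =>
    le_trans (by positivity) (hle z hz _ (hx t j))
  have h1 : ∀ t, ‖x t i - z‖ ^ 2 ≤ n / c * V t := by
    intro t
    have h2 := hle z hz _ (hx t i)
    have h3 : bregman ψ z (x t i) ≤ ∑ j, bregman ψ z (x t j) :=
      Finset.single_le_sum (f := fun j => bregman ψ z (x t j)) (fun j _ => h0 t j)
        (Finset.mem_univ i)
    have h4 := hV t
    rw [one_div, inv_mul_eq_div, div_le_iff₀ hn] at h4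
    rw [norm_sub_rev, div_mul_eq_mul_div, le_div_iff₀ hc]
    linarith
  have h2 : Tendsto (fun t => ‖x t i - z‖ ^ 2) atTop (𝓝 0) :=
    squeeze_zero (fun t => sq_nonneg _) h1 (by simpa using hV0.const_mul (n / c : ℝ))
  rw [tendsto_iff_norm_sub_tendsto_zero]
  simpa [Real.sqrt_sq (norm_nonneg _)] using h2.sqrt

theorem tendsto_of_tendsto_agentMean {m n : ℕ} (hn : 0 < n) {x : ℕ → Fin n → Vec m} {z : Vec m}
    (hz : Tendsto (fun t => agentMean (x t)) atTop (𝓝 z))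
    (hd : Tendsto (fun t => Metric.diam (Set.range (x t))) atTop (𝓝 0)) (i : Fin n) :
    Tendsto (fun t => x t i) atTop (𝓝 z) := by
  have h1 : Tendsto (fun t => x t i - agentMean (x t)) atTop (𝓝 0) :=
    squeeze_zero_norm (fun t => norm_sub_agentMean_le hn (x t) i) hd
  simpa using h1.add hz

end Run

/-! ### Existence, uniqueness and convergence -/

theorem theorem2 {m₁ m₂ n₁ n₂ : ℕ} (hn₁ : 0 < n₁) (hn₂ : 0 < n₂)
    (p₁ p₂ : ENNReal) (hp₁ : 1 ≤ p₁) (hp₂ : 1 ≤ p₂)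
    -- the zero-sum game
    (G : SubnetworkGame m₁ m₂ n₁ n₂) (hzero : G.ZeroSum)
    (L₁₁ L₁₂ L₂₁ L₂₂ : ℝ) (hgame : G.GameAssumption p₁ p₂ L₁₁ L₁₂ L₂₁ L₂₂)
    (hstrict : G.StrictlyConvexConcave)
    -- the communication networks
    (N : CommNetwork n₁ n₂) (η : ℝ) (hnet : N.NetworkAssumption η)
    -- the regularizers and their Bregman divergences
    (ψ₁ : Vec m₁ → ℝ) (ψ₂ : Vec m₂ → ℝ) (σ₁ σ₂ : ℝ)
    (hψ₁ : IsRegularizer p₁ σ₁ G.X₁ ψ₁) (hψ₂ : IsRegularizer p₂ σ₂ G.X₂ ψ₂)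
    (hD₁ : BregmanAssumption G.X₁ ψ₁) (hD₂ : BregmanAssumption G.X₂ ψ₂)
    -- the step sizes
    (α : ℕ → ℝ) (hα_pos : ∀ t, 0 < α t) (hα_mono : Antitone α)
    (hα_sum : Tendsto (fun T => ∑ t ∈ Finset.range T, α t) atTop atTop)
    (hα_sq : Summable (fun t => α t ^ 2))
    -- a run of the algorithm
    (x₁ g₁ : ℕ → Fin n₁ → Vec m₁) (x₂ g₂ : ℕ → Fin n₂ → Vec m₂)
    (hrun : IsRun G N ψ₁ ψ₂ α x₁ g₁ x₂ g₂) :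
    ∃ xs₁ xs₂, G.IsNash xs₁ xs₂ ∧
      (∀ y₁ y₂, G.IsNash y₁ y₂ → y₁ = xs₁ ∧ y₂ = xs₂) ∧
      (∀ i, Tendsto (fun t => x₁ t i) atTop (𝓝 xs₁)) ∧
      (∀ j, Tendsto (fun t => x₂ t j) atTop (𝓝 xs₂)) := by
  obtain ⟨e, he0, he, hdesc⟩ := hrun.exists_totalDivergence_le hn₁ hn₂ hp₁ hp₂ hzero hgame hnet
    hψ₁ hψ₂ hD₁ hD₂ hα_pos hα_mono hα_sq
  have s₁ := (hrun.subnetworkRun₁ hn₁ hp₁ hp₂ hgame hnet hψ₁ hD₁ hα_pos).summable_step_mul_diam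
    hα_mono hα_sq
  have s₂ := (hrun.subnetworkRun₂ hn₂ hp₁ hp₂ hgame hnet hψ₂ hD₂ hα_pos).summable_step_mul_diam
    hα_mono hα_sq
  set y₁ : ℕ → Vec m₁ := fun t => agentMean (x₁ t) with hy₁
  set y₂ : ℕ → Vec m₂ := fun t => agentMean (x₂ t) with hy₂
  have hm₁ : ∀ t, y₁ t ∈ G.X₁ := fun t => agentMean_mem hn₁ hgame.convex₁ (hrun.mem₁ t)
  have hm₂ : ∀ t, y₂ t ∈ G.X₂ := fun t => agentMean_mem hn₂ hgame.convex₂ (hrun.mem₂ t)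
  obtain ⟨c₁, hc₁, hle₁⟩ := hψ₁.exists_le_bregman hp₁
  obtain ⟨c₂, hc₂, hle₂⟩ := hψ₂.exists_le_bregman hp₂
  have hB₁ : ∀ z ∈ G.X₁, ∀ t, 0 ≤ 1 / (n₁ : ℝ) * ∑ i, bregman ψ₁ z (x₁ t i) := fun z hz t =>
    mul_nonneg (by positivity) (Finset.sum_nonneg fun i _ =>
      le_trans (by positivity) (hle₁ z hz _ (hrun.mem₁ t i)))
  have hB₂ : ∀ z ∈ G.X₂, ∀ t, 0 ≤ 1 / (n₂ : ℝ) * ∑ i, bregman ψ₂ z (x₂ t i) := fun z hz t =>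
    mul_nonneg (by positivity) (Finset.sum_nonneg fun i _ =>
      le_trans (by positivity) (hle₂ z hz _ (hrun.mem₂ t i)))
  set V : Vec m₁ → Vec m₂ → ℕ → ℝ := fun z₁ z₂ t => totalDivergence ψ₁ ψ₂ z₁ z₂ (x₁ t) (x₂ t)
    with hV
  have hV0 : ∀ z₁ ∈ G.X₁, ∀ z₂ ∈ G.X₂, ∀ t, 0 ≤ V z₁ z₂ t := fun z₁ hz₁ z₂ hz₂ t =>
    add_nonneg (hB₁ z₁ hz₁ t) (hB₂ z₂ hz₂ t)
  -- The bound is uniform in `T` and holds for every comparison pair. It serves twice: for existence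
  -- of an equilibrium, and for summability of the weighted gap at it.
  have hreg : ∀ z₁ ∈ G.X₁, ∀ z₂ ∈ G.X₂, ∀ T,
      ∑ t ∈ Finset.range T, α t * (G.U (y₁ t) z₂ - G.U z₁ (y₂ t)) ≤ V z₁ z₂ 0 + ∑' t, e t := by
    intro z₁ hz₁ z₂ hz₂ T
    have h1 := le_add_sum_of_succ_le (V := V z₁ z₂)
      (b := fun t => e t - α t * (G.U (y₁ t) z₂ - G.U z₁ (y₂ t)))
      (fun t => by have := hdesc z₁ hz₁ z₂ hz₂ t; simp only [hV, hy₁, hy₂]; linarith) 0 T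
    have h2 := he.sum_le_tsum (Finset.range T) fun t _ => he0 t
    have h3 := hV0 z₁ hz₁ z₂ hz₂ (0 + T)
    simp only [add_zero, Finset.sum_sub_distrib] at h1
    linarith
  obtain ⟨z₁, hz₁, z₂, hz₂, hmin, hmax⟩ := exists_saddlePoint_of_regret_bounded hgame.compact₁
    hgame.compact₂ hgame.convex₁ hgame.convex₂ (U := G.U)
    (fun b hb => (hstrict.1 b hb).convexOn) (fun a ha => (hstrict.2 a ha).concaveOn)
    (fun b hb => hgame.continuousOn_U_left hp₁ hb) (fun a ha => hgame.continuousOn_U_right hp₂ ha)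
    hα_pos hα_sum hm₁ hm₂ fun a ha b hb => ⟨_, hreg a ha b hb⟩
  have hNash : G.IsNash z₁ z₂ := ⟨hz₁, hz₂, hmin, hmax⟩
  set gap : ℕ → ℝ := fun t => G.U (y₁ t) z₂ - G.U z₁ (y₂ t) with hgap
  have hgap0 : ∀ t, 0 ≤ gap t := fun t => by
    have h1 : G.U z₁ z₂ ≤ G.U (y₁ t) z₂ := hmin (hm₁ t)
    have h2 : G.U z₁ (y₂ t) ≤ G.U z₁ z₂ := hmax (hm₂ t)
    simp only [hgap]
    linarith
  have hgap_sum : Summable fun t => α t * gap t :=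
    summable_of_sum_range_le (fun t => mul_nonneg (hα_pos t).le (hgap0 t)) (hreg z₁ hz₁ z₂ hz₂)
  set d₁ : ℕ → ℝ := fun t => Metric.diam (Set.range (x₁ t)) with hd₁
  set d₂ : ℕ → ℝ := fun t => Metric.diam (Set.range (x₂ t)) with hd₂
  have hd₁0 : ∀ t, 0 ≤ d₁ t := fun t => Metric.diam_nonneg
  have hd₂0 : ∀ t, 0 ≤ d₂ t := fun t => Metric.diam_nonneg
  -- The gap and both diameters are nonnegative, so treating their sum makes all three small along
  -- one common subsequence.
  obtain ⟨φ, hφ, hφ0⟩ := exists_subseq_tendsto_zero_of_summable_mul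
    (r := fun t => gap t + d₁ t + d₂ t) hα_pos
    (fun t => add_nonneg (add_nonneg (hgap0 t) (hd₁0 t)) (hd₂0 t)) hα_sum
    (((hgap_sum.add s₁).add s₂).congr fun t => by simp only [hd₁, hd₂]; ring)
  obtain ⟨⟨a, b⟩, ⟨ha, hb⟩, θ, hθ, hlim⟩ := (hgame.compact₁.prod hgame.compact₂).tendsto_subseq
    (x := fun k => (y₁ (φ k), y₂ (φ k))) fun k => ⟨hm₁ _, hm₂ _⟩
  set χ : ℕ → ℕ := fun k => φ (θ k)
  have hχ : StrictMono χ := hφ.comp hθ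
  have hχ0 : Tendsto (fun k => gap (χ k) + d₁ (χ k) + d₂ (χ k)) atTop (𝓝 0) :=
    hφ0.comp hθ.tendsto_atTop
  have hgapχ : Tendsto (fun k => gap (χ k)) atTop (𝓝 0) :=
    squeeze_zero (fun k => hgap0 _) (fun k => by linarith [hd₁0 (χ k), hd₂0 (χ k)]) hχ0
  have hd₁χ : Tendsto (fun k => d₁ (χ k)) atTop (𝓝 0) :=
    squeeze_zero (fun k => hd₁0 _) (fun k => by linarith [hgap0 (χ k), hd₂0 (χ k)]) hχ0
  have hd₂χ : Tendsto (fun k => d₂ (χ k)) atTop (𝓝 0) :=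
    squeeze_zero (fun k => hd₂0 _) (fun k => by linarith [hgap0 (χ k), hd₁0 (χ k)]) hχ0
  have hlim₁ : Tendsto (fun k => y₁ (χ k)) atTop (𝓝 a) := (continuous_fst.tendsto _).comp hlim
  have hlim₂ : Tendsto (fun k => y₂ (χ k)) atTop (𝓝 b) := (continuous_snd.tendsto _).comp hlim
  have hU₁ : Tendsto (fun k => G.U (y₁ (χ k)) z₂) atTop (𝓝 (G.U a z₂)) :=
    (hgame.continuousOn_U_left hp₁ hz₂ a ha).tendsto.comp
      (tendsto_nhdsWithin_iff.2 ⟨hlim₁, Eventually.of_forall fun k => hm₁ _⟩)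
  have hU₂ : Tendsto (fun k => G.U z₁ (y₂ (χ k))) atTop (𝓝 (G.U z₁ b)) :=
    (hgame.continuousOn_U_right hp₂ hz₁ b hb).tendsto.comp
      (tendsto_nhdsWithin_iff.2 ⟨hlim₂, Eventually.of_forall fun k => hm₂ _⟩)
  have hgap_eq : G.U a z₂ - G.U z₁ b = 0 := tendsto_nhds_unique (hU₁.sub hU₂) hgapχ
  obtain ⟨rfl, rfl⟩ := hstrict.eq_of_le hNash ha hb (by linarith)
  have hx₁χ := tendsto_of_tendsto_agentMean hn₁ hlim₁ hd₁χ
  have hx₂χ := tendsto_of_tendsto_agentMean hn₂ hlim₂ hd₂χ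
  -- Along `χ` the means converge to the equilibrium and the diameters vanish, so every single
  -- estimate converges and its divergence tends to zero.
  have hVχ : Tendsto (fun k => V a b (χ k)) atTop (𝓝 0) := by
    have h1 := tendsto_finsetSum Finset.univ fun i _ =>
      hψ₁.tendsto_bregman hz₁ (fun k => hrun.mem₁ (χ k) i) (hx₁χ i)
    have h2 := tendsto_finsetSum Finset.univ fun i _ =>
      hψ₂.tendsto_bregman hz₂ (fun k => hrun.mem₂ (χ k) i) (hx₂χ i)
    simpa [hV, totalDivergence] using
      (h1.const_mul (1 / (n₁ : ℝ))).add (h2.const_mul (1 / (n₂ : ℝ)))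
  have hVlim : Tendsto (V a b) atTop (𝓝 0) := by
    refine tendsto_zero_of_subseq (hV0 a hz₁ b hz₂) he0 he (fun t => ?_) hχ hVχ
    have h1 := hdesc a hz₁ b hz₂ t
    have h2 := mul_nonneg (hα_pos t).le (hgap0 t)
    simp only [hgap, hy₁, hy₂] at h2
    simp only [hV]
    linarith
  refine ⟨a, b, hNash, fun w₁ w₂ hw => ?_, ?_, ?_⟩
  · obtain ⟨hw₁, hw₂, hwmin, hwmax⟩ := hw
    exact hstrict.eq_of_le hNash hw₁ hw₂ (le_trans (hwmax hz₂) (hwmin hz₁))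
  · exact tendsto_of_mean_bregman_le hp₁ hψ₁ hz₁ hrun.mem₁
      (fun t => le_add_of_nonneg_right (hB₂ b hz₂ t)) hVlim
  · exact tendsto_of_mean_bregman_le hp₂ hψ₂ hz₂ hrun.mem₂
      (fun t => le_add_of_nonneg_left (hB₁ a hz₁ t)) hVlim
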